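/- Consider the class of equations $u_t=(D(u)u_x)_x+K(u)u_x$, where the arbitrary elements $D=D(u)$, $K=K(u)$ are smooth functions with $D\neq0$ and $(D_u,K_u)\not\equiv(0,0)$ (nonlinearity). Its equivalence group $G^{\rm equiv}_1$ consists of the local diffeomorphisms of the space of the variables $(t,x,u,D,K)$, $D\ne0$, which act nonsingularly on $(t,x,u)$ and which carry every equation of the class to the equation of the class given by the transformed arbitrary elements; its Lie algebra $A^{\rm equiv}_1$ (the equivalence algebra) consists of the smooth vector fields in $(t,x,u,D,K)$ whose local flows consist of such transformations. Then, on every connected open subset of $\{D\ne0\}$, \[ A^{\rm equiv}_1=\langle \partial_t,\ \partial_x,\ \partial_u,\ u\partial_u,\ t\partial_x-\partial_K,\ 2t\partial_t+x\partial_x-K\partial_K,\ t\partial_t-D\partial_D-K\partial_K\rangle . \] Moreover, the transformations from $G^{\rm equiv}_1$ with connected domain are exactly the local diffeomorphisms with connected domain in $\{D\neq 0\}$ that have the form \[ \tilde t=t\varepsilon_4^2\varepsilon_5+\varepsilon_1,\quad \tilde x=x\varepsilon_4+\varepsilon_7t+\varepsilon_2,\quad \tilde u=u\varepsilon_6+\varepsilon_3,\quad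 \tilde D=D\varepsilon_5^{-1},\quad \tilde K=K\varepsilon_4^{-1}\varepsilon_5^{-1}-\varepsilon_7\varepsilon_4^{-2}\varepsilon_5^{-1}, \] where $\varepsilon_1,\dots,\varepsilon_7$ are arbitrary constants with $\varepsilon_4\varepsilon_5\varepsilon_6\neq0$. -/

import Mathlib

open Filter Topology Set
open scoped ContDiff

/-- The space of the variables `(t, x, u)`. -/
abbrev BaseSpace : Type := Fin 3 → ℝ

/-- The space of the variables `(t, x, u)` extended by the values of the arbitrary elements:
coordinates `0, 1, 2, 3, 4` are `t, x, u, D, K`. -/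
abbrev ExtSpace : Type := Fin 5 → ℝ

/-- The region `D ≠ 0` of the extended space. -/
def diffusiveRegion : Set ExtSpace := {z | z 3 ≠ 0}

/-- The pair of functions `(D, K)` is, near `u₀`, a pair of arbitrary elements of the class
`u_t = (D(u) u_x)_x + K(u) u_x`: both are smooth functions of `u`, `D ≠ 0`, and the equation is
nonlinear near `u₀`, i.e. `(D_u, K_u)` does not vanish identically near `u₀`. -/
structure IsArbitraryElementAt (D K : ℝ → ℝ) (u₀ : ℝ) : Prop where
  smooth_D : ∀ᶠ u in 𝓝 u₀, ContDiffAt ℝ ∞ D u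
  smooth_K : ∀ᶠ u in 𝓝 u₀, ContDiffAt ℝ ∞ K u
  ne_zero : D u₀ ≠ 0
  nonlinear : ¬ ∀ᶠ u in 𝓝 u₀, deriv D u = 0 ∧ deriv K u = 0

/-- The function `w (t, x)` satisfies `w_t = (D(w) w_x)_x + K(w) w_x` at the point `(t, x)`.
For a smooth `w` this is a condition on the 2-jet of `w` at `(t, x)`. -/
def SatisfiesAt (D K : ℝ → ℝ) (w : ℝ → ℝ → ℝ) (t x : ℝ) : Prop :=
  deriv (fun s => w s x) t =
    deriv (fun y => D (w t y) * deriv (w t) y) x + K (w t x) * deriv (w t) x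

/-- The point transformation `φ` of the space `(t, x, u)` carries, over the point `q`, the equation
with the coefficients `(D, K)` to the equation with the coefficients `(D', K')`. Both equations are
regarded as conditions on 2-jets, and the (prolonged) action of `φ` on the jets is the one induced
by its action on graphs of smooth functions: whenever `φ` carries the graph of `w` near `q` to the
graph of `w'`, the 2-jet of `w` at `q` lies on the first equation iff the 2-jet of `w'` at `φ q`
lies on the second one. -/
def CarriesEquationAt (φ : BaseSpace → BaseSpace) (D K D' K' : ℝ → ℝ) (q : BaseSpace) : Prop :=
  ∀ w w' : ℝ → ℝ → ℝ,
    ContDiffAt ℝ ∞ (fun s : ℝ × ℝ => w s.1 s.2) (q 0, q 1) →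
    w (q 0) (q 1) = q 2 →
    ContDiffAt ℝ ∞ (fun s : ℝ × ℝ => w' s.1 s.2) (φ q 0, φ q 1) →
    (∀ᶠ s : ℝ × ℝ in 𝓝 (q 0, q 1),
      w' (φ ![s.1, s.2, w s.1 s.2] 0) (φ ![s.1, s.2, w s.1 s.2] 1) =
        φ ![s.1, s.2, w s.1 s.2] 2) →
    (SatisfiesAt D K w (q 0) (q 1) ↔ SatisfiesAt D' K' w' (φ q 0) (φ q 1))

/-- The point of the extended space over `q = (t, x, u)` given by the arbitrary elements
`D = D(u)`, `K = K(u)`. -/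
def liftPoint (D K : ℝ → ℝ) (q : BaseSpace) : ExtSpace := ![q 0, q 1, q 2, D (q 2), K (q 2)]

/-- The transformation of `(t, x, u)` that a transformation `Φ` of the extended space induces for
fixed arbitrary elements `D = D(u)`, `K = K(u)`. -/
def inducedMap (Φ : ExtSpace → ExtSpace) (D K : ℝ → ℝ) (q : BaseSpace) : BaseSpace :=
  ![Φ (liftPoint D K q) 0, Φ (liftPoint D K q) 1, Φ (liftPoint D K q) 2]

/-- A map of the space `(t, x, u)` is nonsingular at `q`. -/
def NonsingularAt (φ : BaseSpace → BaseSpace) (q : BaseSpace) : Prop :=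
  Function.Bijective (fderiv ℝ φ q)

/-- `Φ` is a local equivalence transformation of the class `u_t = (D(u) u_x)_x + K(u) u_x`: a local
diffeomorphism of the space `(t, x, u, D, K)` (the new `t, x, u` may depend on `D, K` as well) that
preserves the form of the equations of the class. -/
structure IsEquivalenceTransformation (Φ : OpenPartialHomeomorph ExtSpace ExtSpace) : Prop where
  source_subset : Φ.source ⊆ diffusiveRegion
  smooth : ContDiffOn ℝ ∞ Φ Φ.source
  smooth_symm : ContDiffOn ℝ ∞ Φ.symm Φ.target
  /-- At every point `Φ` acts nonsingularly on `(t, x, u)` for some arbitrary elements. -/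
  nondegenerate : ∀ z ∈ Φ.source, ∃ (D K : ℝ → ℝ) (q : BaseSpace),
    IsArbitraryElementAt D K (q 2) ∧ liftPoint D K q = z ∧ NonsingularAt (inducedMap Φ D K) q
  /-- Whenever the induced transformation of `(t, x, u)` is nonsingular at `q₀`, the transformed
  arbitrary elements are arbitrary elements of the class again, in particular functions of the new
  `u` only, and the equation is carried to the one with the transformed arbitrary elements. -/
  preserves : ∀ (D K : ℝ → ℝ) (q₀ : BaseSpace),
    IsArbitraryElementAt D K (q₀ 2) → liftPoint D K q₀ ∈ Φ.source →
    NonsingularAt (inducedMap Φ D K) q₀ →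
    ∃ D' K' : ℝ → ℝ, IsArbitraryElementAt D' K' (inducedMap Φ D K q₀ 2) ∧
      ∀ᶠ q in 𝓝 q₀,
        Φ (liftPoint D K q) 3 = D' (inducedMap Φ D K q 2) ∧
        Φ (liftPoint D K q) 4 = K' (inducedMap Φ D K q 2) ∧
        CarriesEquationAt (inducedMap Φ D K) D K D' K' q

/-- The vector field `V` on the open set `Ω` belongs to the Lie algebra of the equivalence
(pseudo)group: it is smooth and its local flow consists of equivalence transformations. -/
structure IsEquivalenceOperatorOn (Ω : Set ExtSpace) (V : ExtSpace → ExtSpace) : Prop where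
  smooth : ContDiffOn ℝ ∞ V Ω
  flow : ∀ z₀ ∈ Ω, ∃ δ > (0 : ℝ), ∃ N : Set ExtSpace, IsOpen N ∧ z₀ ∈ N ∧
    ∃ F : ℝ → ExtSpace → ExtSpace,
      (∀ z ∈ N, F 0 z = z) ∧
      (∀ s ∈ Ioo (-δ) δ, ∀ z ∈ N,
        F s z ∈ Ω ∧ HasDerivAt (fun r => F r z) (V (F s z)) s) ∧
      ∀ s ∈ Ioo (-δ) δ, ∃ Φ : OpenPartialHomeomorph ExtSpace ExtSpace,
        IsEquivalenceTransformation Φ ∧ Φ.source = N ∧ EqOn Φ (F s) N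

/-- The span of `∂_t`, `∂_x`, `∂_u`, `u∂_u`, `t∂_x - ∂_K`, `2t∂_t + x∂_x - K∂_K` and
`t∂_t - D∂_D - K∂_K`. -/
def equivalenceSpan : Submodule ℝ (ExtSpace → ExtSpace) :=
  Submodule.span ℝ
    {fun _ => ![1, 0, 0, 0, 0],
     fun _ => ![0, 1, 0, 0, 0],
     fun _ => ![0, 0, 1, 0, 0],
     fun z => ![0, 0, z 2, 0, 0],
     fun z => ![0, z 0, 0, 0, -1],
     fun z => ![2 * z 0, z 1, 0, 0, -z 4],
     fun z => ![z 0, 0, 0, -z 3, -z 4]}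

/-!
Prescribing the 2-jet of the graph of `u` at a point turns the condition that `Φ` carries every
equation of the class to an equation of the class into polynomial identities in `u_x` and `u_xx`.
Expanding them shows that `t̃` depends on `t` only, that `x̃` does not depend on `u`, and that
`D̃ t̃_t = D x̃_x²`. The arbitrary elements can have any prescribed slopes and second derivatives at
a point, so the identities split with respect to these as well: `D̃` and `K̃` are determined by the
Jacobian of the point transformation, and all second derivatives of `t̃`, `x̃`, `ũ` vanish. Hence
`Φ` is affine in `(t, x, u)`, and the relations that remain are those between the parameters
`ε₁, …, ε₇`.

The coefficients of an operator are the derivatives at time zero of the parameters of its flow,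
and they are locally constant. Conversely, the parameters of the flow of a field in the span solve
scalar linear differential equations, one after the other.
-/

section Calculus

/-- The partial derivative of a function of finitely many real variables in the direction of the
`j`-th coordinate. -/
noncomputable def pderiv {ι : Type*} [Fintype ι] [DecidableEq ι] (j : ι) (f : (ι → ℝ) → ℝ)
    (z : ι → ℝ) : ℝ :=
  fderiv ℝ f z (Pi.single j 1)

/-- The Jacobian matrix of a map between spaces of real vectors. -/
noncomputable def jacobian {ι κ : Type*} [Fintype ι] [DecidableEq ι] (φ : (ι → ℝ) → κ → ℝ)
    (q : ι → ℝ) : Matrix κ ι ℝ :=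
  Matrix.of fun i j => pderiv j (fun y => φ y i) q

theorem jacobian_apply {ι κ : Type*} [Fintype ι] [DecidableEq ι] (φ : (ι → ℝ) → κ → ℝ) (q : ι → ℝ)
    (i : κ) (j : ι) : jacobian φ q i j = pderiv j (fun y => φ y i) q :=
  rfl

section PartialDerivatives

variable {ι : Type*} [Fintype ι] [DecidableEq ι] {f g : (ι → ℝ) → ℝ} {z : ι → ℝ} {S : Set (ι → ℝ)}

theorem fderiv_apply_eq_sum_pderiv (f : (ι → ℝ) → ℝ) (z v : ι → ℝ) :
    fderiv ℝ f z v = ∑ j, v j * pderiv j f z := by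
  conv_lhs => rw [pi_eq_sum_univ' v]
  simp only [map_sum, map_smul, smul_eq_mul, pderiv]

theorem differentiableAt_pderiv (hf : ContDiffAt ℝ 2 f z) (j : ι) :
    DifferentiableAt ℝ (pderiv j f) z :=
  ((hf.fderiv_right (m := 1) (by norm_num)).differentiableAt (by simp)).clm_apply
    (differentiableAt_const _)

theorem pderiv_pderiv (hf : ContDiffAt ℝ 2 f z) (i j : ι) :
    pderiv i (pderiv j f) z =
      fderiv ℝ (fderiv ℝ f) z (Pi.single i 1) (Pi.single j 1) := by
  have h := (hf.fderiv_right (m := 1) (by norm_num)).differentiableAt (by simp)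
  have h' := h.hasFDerivAt.clm_apply (hasFDerivAt_const (Pi.single j (1 : ℝ)) z)
  rw [pderiv, show pderiv j f = fun y => fderiv ℝ f y (Pi.single j 1) from rfl, h'.fderiv]
  simp

theorem pderiv_comm (hf : ContDiffAt ℝ 2 f z) (i j : ι) :
    pderiv i (pderiv j f) z = pderiv j (pderiv i f) z := by
  rw [pderiv_pderiv hf, pderiv_pderiv hf]
  exact hf.isSymmSndFDerivAt (by simp) _ _

theorem fderiv_fderiv_apply_eq_sum_pderiv (hf : ContDiffAt ℝ 2 f z) (v w : ι → ℝ) :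
    fderiv ℝ (fderiv ℝ f) z v w = ∑ i, ∑ j, v i * w j * pderiv i (pderiv j f) z := by
  conv_lhs => rw [pi_eq_sum_univ' v, pi_eq_sum_univ' w]
  simp only [map_sum, map_smul, sum_apply, smul_apply,
    smul_eq_mul, pderiv_pderiv hf, Finset.mul_sum, mul_assoc]
  exact Finset.sum_comm.trans <| Finset.sum_congr rfl fun _ _ => Finset.sum_congr rfl fun _ _ => by
    ring

theorem pderiv_coord (i j : ι) (z : ι → ℝ) :
    pderiv j (fun y => y i) z = if i = j then 1 else 0 := by
  rw [pderiv, (hasFDerivAt_apply i z).fderiv, ContinuousLinearMap.proj_apply, Pi.single_apply]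

theorem pderiv_mul (hf : DifferentiableAt ℝ f z) (hg : DifferentiableAt ℝ g z) (j : ι) :
    pderiv j (fun y => f y * g y) z = f z * pderiv j g z + g z * pderiv j f z := by
  simp [pderiv, fderiv_fun_mul hf hg]

theorem pderiv_sub (hf : DifferentiableAt ℝ f z) (hg : DifferentiableAt ℝ g z) (j : ι) :
    pderiv j (fun y => f y - g y) z = pderiv j f z - pderiv j g z := by
  simp [pderiv, fderiv_fun_sub hf hg]

theorem pderiv_comp {h : ℝ → ℝ} (hh : DifferentiableAt ℝ h (f z)) (hf : DifferentiableAt ℝ f z)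
    (j : ι) : pderiv j (fun y => h (f y)) z = deriv h (f z) * pderiv j f z := by
  have := hh.hasDerivAt.comp_hasFDerivAt z hf.hasFDerivAt
  simp only [pderiv, ← Function.comp_def, this.fderiv, smul_apply, smul_eq_mul]

theorem pderiv_jacobian {κ : Type*} (φ : (ι → ℝ) → κ → ℝ) (i : κ) (j k : ι) (z : ι → ℝ) :
    pderiv k (fun y => jacobian φ y i j) z = pderiv k (pderiv j fun y => φ y i) z :=
  rfl

theorem pderiv_pderiv_eq_zero_of_jacobian_eq_zero {κ : Type*} {φ : (ι → ℝ) → κ → ℝ} {i : κ} {j : ι}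
    (h : ∀ᶠ y in 𝓝 z, jacobian φ y i j = 0) (k : ι) :
    pderiv k (pderiv j fun y => φ y i) z = 0 := by
  have h' : (pderiv j fun y => φ y i) =ᶠ[𝓝 z] fun _ => 0 := h
  rw [pderiv, h'.fderiv_eq]
  simp

theorem pderiv_eq_of_eqOn (hS : IsOpen S) (h : EqOn f g S) (hz : z ∈ S) (j : ι) :
    pderiv j f z = pderiv j g z := by
  rw [pderiv, (h.eventuallyEq_of_mem (hS.mem_nhds hz)).fderiv_eq, pderiv]

theorem eq_of_pderiv_eq_zero (hS : IsOpen S) (hS' : IsPreconnected S)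
    (hf : ∀ y ∈ S, DifferentiableAt ℝ f y) (h : ∀ y ∈ S, ∀ j, pderiv j f y = 0) {y : ι → ℝ}
    (hz : z ∈ S) (hy : y ∈ S) : f y = f z :=
  hS.is_const_of_fderiv_eq_zero hS' (fun x hx => (hf x hx).differentiableWithinAt)
    (fun x hx => by ext v; simp [fderiv_apply_eq_sum_pderiv, h x hx]) hy hz

theorem eq_add_fderiv_of_fderiv_fderiv_eq_zero {E F : Type*} [NormedAddCommGroup E]
    [NormedSpace ℝ E] [NormedAddCommGroup F] [NormedSpace ℝ F] {f : E → F} {S : Set E}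
    (hS : IsOpen S) (hS' : IsPreconnected S) (hf : ∀ y ∈ S, ContDiffAt ℝ 2 f y)
    (h : ∀ y ∈ S, fderiv ℝ (fderiv ℝ f) y = 0) {y z : E} (hz : z ∈ S) (hy : y ∈ S) :
    f y = f z + fderiv ℝ f z (y - z) := by
  have hconst : ∀ x ∈ S, fderiv ℝ f x = fderiv ℝ f z := fun x hx =>
    hS.is_const_of_fderiv_eq_zero hS' (fun x hx => (((hf x hx).fderiv_right (m := 1)
      (by norm_num)).differentiableAt (by simp)).differentiableWithinAt) h hx hz
  have haff : ∀ x, HasFDerivAt (fun x => f z + fderiv ℝ f z (x - z)) (fderiv ℝ f z) x := fun x =>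
    ((fderiv ℝ f z).hasFDerivAt.comp x ((hasFDerivAt_id x).sub_const z)).const_add (f z)
  exact hS.eqOn_of_fderiv_eq hS'
    (fun x hx => ((hf x hx).differentiableAt (by simp)).differentiableWithinAt)
    (fun x _ => (haff x).differentiableAt.differentiableWithinAt)
    (fun x hx => by rw [hconst x hx, (haff x).fderiv]) hz (by simp) hy

theorem eq_add_sum_pderiv_of_pderiv_pderiv_eq_zero (hS : IsOpen S) (hS' : IsPreconnected S)
    (hf : ∀ y ∈ S, ContDiffAt ℝ 2 f y) (h : ∀ y ∈ S, ∀ i j, pderiv i (pderiv j f) y = 0)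
    {y : ι → ℝ} (hz : z ∈ S) (hy : y ∈ S) :
    f y = f z + ∑ j, (y j - z j) * pderiv j f z := by
  rw [eq_add_fderiv_of_fderiv_fderiv_eq_zero hS hS' hf (fun x hx => ?_) hz hy,
    fderiv_apply_eq_sum_pderiv]
  · rfl
  · ext v w
    simp [fderiv_fderiv_apply_eq_sum_pderiv (hf x hx), h x hx]

end PartialDerivatives

section Curves

variable {E F : Type*} [NormedAddCommGroup E] [NormedSpace ℝ E] [NormedAddCommGroup F]
  [NormedSpace ℝ F]

theorem differentiableAt_deriv {γ : ℝ → E} {s : ℝ} (hγ : ContDiffAt ℝ 2 γ s) :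
    DifferentiableAt ℝ (deriv γ) s :=
  (hγ.derivWithin (m := 1) (by norm_num)).differentiableAt (by simp)

theorem deriv_comp_curve {f : E → F} {γ : ℝ → E} {s : ℝ} (hf : DifferentiableAt ℝ f (γ s))
    (hγ : DifferentiableAt ℝ γ s) :
    deriv (fun y => f (γ y)) s = fderiv ℝ f (γ s) (deriv γ s) :=
  (hf.hasFDerivAt.comp_hasDerivAt s hγ.hasDerivAt).deriv

theorem deriv_deriv_comp_curve {f : E → F} {γ : ℝ → E} {s : ℝ}
    (hf : ContDiffAt ℝ 2 f (γ s)) (hγ : ContDiffAt ℝ 2 γ s) :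
    deriv (deriv fun y => f (γ y)) s =
      fderiv ℝ (fderiv ℝ f) (γ s) (deriv γ s) (deriv γ s) +
        fderiv ℝ f (γ s) (deriv (deriv γ) s) := by
  have hfirst : deriv (fun y => f (γ y)) =ᶠ[𝓝 s] fun y => fderiv ℝ f (γ y) (deriv γ y) := by
    filter_upwards [hγ.continuousAt.eventually (hf.eventually (by simp)),
      hγ.eventually (by simp)] with y hfy hγy
    exact deriv_comp_curve (hfy.differentiableAt (by simp)) (hγy.differentiableAt (by simp))
  have hf' : DifferentiableAt ℝ (fderiv ℝ f) (γ s) :=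
    (hf.fderiv_right (m := 1) (by norm_num)).differentiableAt (by simp)
  rw [hfirst.deriv_eq]
  have hγ' := (hγ.differentiableAt (by simp)).hasDerivAt
  exact ((hf'.hasFDerivAt.comp_hasDerivAt s hγ').clm_apply
    (differentiableAt_deriv hγ).hasDerivAt).deriv

/-- The parabola through `x` at time `s₀` with velocity `v` at `s₀` and acceleration `κ`. -/
noncomputable def quadraticPath (x v κ : E) (s₀ s : ℝ) : E :=
  x + (s - s₀) • v + ((s - s₀) ^ 2 / 2) • κ

theorem quadraticPath_self (x v κ : E) (s₀ : ℝ) : quadraticPath x v κ s₀ s₀ = x := by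
  simp [quadraticPath]

theorem contDiff_quadraticPath {n : ℕ∞ω} (x v κ : E) (s₀ : ℝ) :
    ContDiff ℝ n (quadraticPath x v κ s₀) := by
  unfold quadraticPath
  fun_prop

theorem deriv_quadraticPath (x v κ : E) (s₀ : ℝ) :
    deriv (quadraticPath x v κ s₀) = fun s => v + (s - s₀) • κ := by
  ext1 s
  have hlin : HasDerivAt (fun s : ℝ => s - s₀) 1 s := (hasDerivAt_id s).sub_const s₀
  have := ((hlin.smul_const v).const_add x).add (((hlin.pow 2).div_const 2).smul_const κ)
  refine (this.congr_deriv ?_).deriv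
  congr 2 <;> simp

theorem deriv_deriv_quadraticPath (x v κ : E) (s₀ s : ℝ) :
    deriv (deriv (quadraticPath x v κ s₀)) s = κ := by
  rw [deriv_quadraticPath]
  have := (((hasDerivAt_id s).sub_const s₀).smul_const κ).const_add v
  simpa using this.deriv

theorem deriv_comp_quadraticPath {f : E → F} {x : E} (hf : DifferentiableAt ℝ f x) (v κ : E)
    (s₀ : ℝ) : deriv (fun s => f (quadraticPath x v κ s₀ s)) s₀ = fderiv ℝ f x v := by
  have hx := quadraticPath_self x v κ s₀
  rw [deriv_comp_curve (γ := quadraticPath x v κ s₀) (by rwa [hx])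
    ((contDiff_quadraticPath (n := 1) x v κ s₀).differentiable (by simp) s₀), hx,
    deriv_quadraticPath]
  simp

theorem deriv_deriv_comp_quadraticPath {f : E → F} {x : E} (hf : ContDiffAt ℝ 2 f x) (v κ : E)
    (s₀ : ℝ) :
    deriv (deriv fun s => f (quadraticPath x v κ s₀ s)) s₀ =
      fderiv ℝ (fderiv ℝ f) x v v + fderiv ℝ f x κ := by
  have hx := quadraticPath_self x v κ s₀
  rw [deriv_deriv_comp_curve (γ := quadraticPath x v κ s₀) (by rwa [hx])
    (contDiff_quadraticPath x v κ s₀).contDiffAt, hx, deriv_deriv_quadraticPath,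
    deriv_quadraticPath]
  simp

theorem exists_comp_eventuallyEq_of_injective_fderiv [FiniteDimensional ℝ E] {n : ℕ∞ω}
    (hn : n ≠ 0) {A : E → E} {B : E → F} {x : E} (hA : ContDiffAt ℝ n A x)
    (hB : ContDiffAt ℝ n B x) (hinj : Function.Injective (fderiv ℝ A x)) :
    ∃ W : E → F, ContDiffAt ℝ n W (A x) ∧ ∀ᶠ y in 𝓝 x, W (A y) = B y := by
  have := FiniteDimensional.complete ℝ E
  let A' : E ≃L[ℝ] E :=
    (LinearEquiv.ofInjectiveEndo (fderiv ℝ A x : E →ₗ[ℝ] E) hinj).toContinuousLinearEquiv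
  have hA' : HasFDerivAt A (A' : E →L[ℝ] E) x := (hA.differentiableAt hn).hasFDerivAt
  have hleft := (hA.hasStrictFDerivAt' hA' hn).eventually_left_inverse
  refine ⟨B ∘ hA.localInverse hA' hn, ContDiffAt.comp (A x) ?_ (hA.to_localInverse hA' hn), ?_⟩
  · rwa [show hA.localInverse hA' hn (A x) = x from hleft.self_of_nhds]
  · exact hleft.mono fun y hy => congrArg B hy

section TwoVariables

variable {w : ℝ → ℝ → ℝ} {ψ₀ ψ₁ ψ₂ : ℝ → ℝ} {s a b : ℝ}

theorem fderiv_uncurry_apply (hw : DifferentiableAt ℝ (fun y : ℝ × ℝ => w y.1 y.2) (a, b))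
    (v : ℝ × ℝ) :
    fderiv ℝ (fun y : ℝ × ℝ => w y.1 y.2) (a, b) v =
      deriv (fun t => w t b) a * v.1 + deriv (w a) b * v.2 := by
  have hleft := deriv_comp_curve (γ := fun t => (t, b)) (s := a) hw (by fun_prop)
  have hright := deriv_comp_curve (γ := fun y => (a, y)) (s := b) hw (by fun_prop)
  rw [((hasDerivAt_id' a).prodMk (hasDerivAt_const a b)).deriv] at hleft
  rw [((hasDerivAt_const b a).prodMk (hasDerivAt_id' b)).deriv] at hright
  have hv : v = v.1 • (1, 0) + v.2 • (0, 1) := by simp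
  conv_lhs => rw [hv]
  rw [map_add, map_smul, map_smul, ← hleft, ← hright, smul_eq_mul, smul_eq_mul]
  ring

theorem fderiv_fderiv_uncurry_apply (hw : ContDiffAt ℝ 2 (fun y : ℝ × ℝ => w y.1 y.2) (a, b)) :
    fderiv ℝ (fderiv ℝ fun y : ℝ × ℝ => w y.1 y.2) (a, b) (0, 1) (0, 1) =
      deriv (deriv (w a)) b := by
  have hline (y : ℝ) : deriv (fun y => (a, y)) y = ((0 : ℝ), (1 : ℝ)) :=
    ((hasDerivAt_const y a).prodMk (hasDerivAt_id' y)).deriv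
  have := deriv_deriv_comp_curve (γ := fun y => (a, y)) (s := b) hw (by fun_prop)
  rw [funext hline, deriv_const, map_zero, add_zero] at this
  exact this.symm

theorem deriv_eq_of_curve_in_graph
    (hw : DifferentiableAt ℝ (fun y : ℝ × ℝ => w y.1 y.2) (ψ₀ s, ψ₁ s))
    (hψ₀ : DifferentiableAt ℝ ψ₀ s) (hψ₁ : DifferentiableAt ℝ ψ₁ s)
    (h : ∀ᶠ y in 𝓝 s, w (ψ₀ y) (ψ₁ y) = ψ₂ y) :
    deriv (fun t => w t (ψ₁ s)) (ψ₀ s) * deriv ψ₀ s + deriv (w (ψ₀ s)) (ψ₁ s) * deriv ψ₁ s =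
      deriv ψ₂ s := by
  have hγ := deriv_comp_curve (γ := fun y => (ψ₀ y, ψ₁ y)) hw (hψ₀.prodMk hψ₁)
  rw [(hψ₀.hasDerivAt.prodMk hψ₁.hasDerivAt).deriv, fderiv_uncurry_apply hw] at hγ
  rw [← hγ, EventuallyEq.deriv_eq h]

theorem deriv_deriv_eq_of_curve_in_graph
    (hw : ContDiffAt ℝ 2 (fun y : ℝ × ℝ => w y.1 y.2) (ψ₀ s, ψ₁ s))
    (hψ₀ : ContDiffAt ℝ 2 ψ₀ s) (hψ₁ : ContDiffAt ℝ 2 ψ₁ s) (hψ₀' : deriv ψ₀ s = 0)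
    (h : ∀ᶠ y in 𝓝 s, w (ψ₀ y) (ψ₁ y) = ψ₂ y) :
    deriv (deriv (w (ψ₀ s))) (ψ₁ s) * deriv ψ₁ s ^ 2 +
        deriv (fun t => w t (ψ₁ s)) (ψ₀ s) * deriv (deriv ψ₀) s +
        deriv (w (ψ₀ s)) (ψ₁ s) * deriv (deriv ψ₁) s = deriv (deriv ψ₂) s := by
  have hderiv : deriv (fun y => (ψ₀ y, ψ₁ y)) =ᶠ[𝓝 s] fun y => (deriv ψ₀ y, deriv ψ₁ y) := by
    filter_upwards [hψ₀.eventually (by simp), hψ₁.eventually (by simp)] with y h₀ h₁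
    exact ((h₀.differentiableAt (by simp)).hasDerivAt.prodMk
      (h₁.differentiableAt (by simp)).hasDerivAt).deriv
  have hvelocity : deriv (fun y => (ψ₀ y, ψ₁ y)) s = deriv ψ₁ s • (0, 1) := by
    rw [hderiv.eq_of_nhds]
    simp [hψ₀']
  have hγ := deriv_deriv_comp_curve (γ := fun y => (ψ₀ y, ψ₁ y)) hw (hψ₀.prodMk hψ₁)
  rw [hderiv.deriv_eq, ((differentiableAt_deriv hψ₀).hasDerivAt.prodMk
    (differentiableAt_deriv hψ₁).hasDerivAt).deriv, hvelocity,
    map_smul, map_smul, smul_apply, fderiv_fderiv_uncurry_apply hw,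
    fderiv_uncurry_apply (hw.differentiableAt (by simp)), smul_eq_mul, smul_eq_mul] at hγ
  rw [← (EventuallyEq.deriv h).deriv_eq, hγ]
  ring

end TwoVariables

end Curves

end Calculus

section PointTransformations

theorem two_le_infty : (2 : ℕ∞ω) ≤ ∞ := WithTop.coe_le_coe.2 le_top

theorem satisfiesAt_iff {D K : ℝ → ℝ} {w : ℝ → ℝ → ℝ} {t x : ℝ}
    (hw : ContDiffAt ℝ 2 (w t) x) (hD : DifferentiableAt ℝ D (w t x)) :
    SatisfiesAt D K w t x ↔ deriv (fun s => w s x) t =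
      D (w t x) * deriv (deriv (w t)) x + deriv D (w t x) * deriv (w t) x ^ 2 +
        K (w t x) * deriv (w t) x := by
  have hDw : HasDerivAt (fun y => D (w t y)) (deriv D (w t x) * deriv (w t) x) x :=
    hD.hasDerivAt.comp x (hw.differentiableAt (by simp)).hasDerivAt
  unfold SatisfiesAt
  rw [(hDw.fun_mul (differentiableAt_deriv hw).hasDerivAt).deriv]
  ring_nf

/-- The Jacobian determinant of the `i`-th and `j`-th components of `φ` with respect to the total
derivatives `∂_t + τ ∂_u` and `∂_x + p ∂_u`, that is, of these components restricted to the graph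
of a function `u` of `(t, x)` with `u_t = τ` and `u_x = p`. -/
noncomputable def graphMinor (φ : BaseSpace → BaseSpace) (q : BaseSpace) (τ p : ℝ)
    (i j : Fin 3) : ℝ :=
  (jacobian φ q i 0 + τ * jacobian φ q i 2) * (jacobian φ q j 1 + p * jacobian φ q j 2) -
    (jacobian φ q j 0 + τ * jacobian φ q j 2) * (jacobian φ q i 1 + p * jacobian φ q i 2)

/-- The second derivative of the `i`-th component of `φ` along a curve that passes through `q` with
velocity `v` and acceleration `κ`. -/
noncomputable def secondVariation (φ : BaseSpace → BaseSpace) (q v κ : BaseSpace) (i : Fin 3) : ℝ :=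
  fderiv ℝ (fderiv ℝ fun y => φ y i) q v v + fderiv ℝ (fun y => φ y i) q κ

/-- The point of the graph of `w` over `s = (t, x)`. -/
def graphPoint (w : ℝ → ℝ → ℝ) (s : ℝ × ℝ) : BaseSpace := ![s.1, s.2, w s.1 s.2]

/-- The polynomial `u(t, x)` with the 2-jet `u_t = τ`, `u_x = p`, `u_tt = m`, `u_tx = 0`, `u_xx = r`
over the point `q`. -/
noncomputable def jetPolynomial (q : BaseSpace) (τ p m r t x : ℝ) : ℝ :=
  quadraticPath (q 2) τ m (q 0) t + quadraticPath 0 p r (q 1) x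

section JetPolynomial

variable (q : BaseSpace) (τ p m r : ℝ)

theorem contDiff_jetPolynomial :
    ContDiff ℝ ∞ fun s : ℝ × ℝ => jetPolynomial q τ p m r s.1 s.2 :=
  ((contDiff_quadraticPath _ _ _ _).comp contDiff_fst).add
    ((contDiff_quadraticPath _ _ _ _).comp contDiff_snd)

theorem jetPolynomial_self : jetPolynomial q τ p m r (q 0) (q 1) = q 2 := by
  simp [jetPolynomial, quadraticPath_self]

theorem jetPolynomial_left :
    (fun t => jetPolynomial q τ p m r t (q 1)) = quadraticPath (q 2) τ m (q 0) := by
  simp [jetPolynomial, quadraticPath_self]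

theorem jetPolynomial_right :
    jetPolynomial q τ p m r (q 0) = quadraticPath (q 2) p r (q 1) := by
  ext x
  simp [jetPolynomial, quadraticPath]
  ring

theorem deriv_jetPolynomial_left : deriv (fun t => jetPolynomial q τ p m r t (q 1)) (q 0) = τ := by
  rw [jetPolynomial_left, deriv_quadraticPath]
  simp

theorem deriv_jetPolynomial_right : deriv (jetPolynomial q τ p m r (q 0)) (q 1) = p := by
  rw [jetPolynomial_right, deriv_quadraticPath]
  simp

theorem satisfiesAt_jetPolynomial_iff {D K : ℝ → ℝ} (hD : DifferentiableAt ℝ D (q 2)) :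
    SatisfiesAt D K (jetPolynomial q τ p m r) (q 0) (q 1) ↔
      τ = D (q 2) * r + deriv D (q 2) * p ^ 2 + K (q 2) * p := by
  have hself := jetPolynomial_self q τ p m r
  rw [satisfiesAt_iff _ (by rwa [hself]), hself, deriv_jetPolynomial_left,
    deriv_jetPolynomial_right, jetPolynomial_right, deriv_deriv_quadraticPath]
  · rw [jetPolynomial_right]
    exact (contDiff_quadraticPath _ _ _ _).contDiffAt

theorem graph_jetPolynomial_eq_quadraticPath (ξ η s : ℝ) :
    graphPoint (jetPolynomial q τ p m r) (q 0 + s * ξ, q 1 + s * η) =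
      quadraticPath q ![ξ, η, τ * ξ + p * η] ![0, 0, m * ξ ^ 2 + r * η ^ 2] 0 s := by
  ext i
  simp only [quadraticPath, Pi.add_apply, Pi.smul_apply, smul_eq_mul]
  fin_cases i <;> simp [graphPoint, jetPolynomial, quadraticPath]
  ring

end JetPolynomial

theorem nonsingularAt_iff_det_jacobian_ne_zero {φ : BaseSpace → BaseSpace} {q : BaseSpace}
    (hφ : DifferentiableAt ℝ φ q) : NonsingularAt φ q ↔ (jacobian φ q).det ≠ 0 := by
  have hmul : ⇑(fderiv ℝ φ q) = (jacobian φ q).mulVec := by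
    ext v i
    have := congrArg (· v) (fderiv_apply hφ i)
    simp only [ContinuousLinearMap.comp_apply, ContinuousLinearMap.proj_apply] at this
    rw [← this, fderiv_apply_eq_sum_pderiv]
    simp only [jacobian, Matrix.mulVec, dotProduct, Matrix.of_apply, mul_comm]
  rw [NonsingularAt, hmul, Function.Bijective, Matrix.mulVec_injective_iff_isUnit,
    Matrix.mulVec_surjective_iff_isUnit, and_self, Matrix.isUnit_iff_isUnit_det, isUnit_iff_ne_zero]

theorem eventually_nonsingularAt {φ : BaseSpace → BaseSpace} {q : BaseSpace}
    (hφ : ContDiffAt ℝ 2 φ q) (h : NonsingularAt φ q) : ∀ᶠ y in 𝓝 q, NonsingularAt φ y := by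
  have hdet : ContinuousAt (fun y => (jacobian φ y).det) q := by
    refine Continuous.continuousAt (f := Matrix.det) (by fun_prop) |>.comp ?_
    exact continuousAt_pi.2 fun i => continuousAt_pi.2 fun j =>
      (differentiableAt_pderiv (contDiffAt_pi.1 hφ i) j).continuousAt
  have hdet0 := (nonsingularAt_iff_det_jacobian_ne_zero (hφ.differentiableAt (by simp))).1 h
  filter_upwards [hdet.eventually_ne hdet0, hφ.eventually (by simp)] with y hy hφy
  exact (nonsingularAt_iff_det_jacobian_ne_zero (hφy.differentiableAt (by simp))).2 hy

theorem fderiv_graphPoint {w : ℝ → ℝ → ℝ} {s : ℝ × ℝ}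
    (hw : DifferentiableAt ℝ (fun s : ℝ × ℝ => w s.1 s.2) s) (v : ℝ × ℝ) :
    fderiv ℝ (graphPoint w) s v =
      ![v.1, v.2, deriv (fun t => w t s.2) s.1 * v.1 + deriv (w s.1) s.2 * v.2] := by
  have h : HasFDerivAt (graphPoint w) (ContinuousLinearMap.pi
      ![ContinuousLinearMap.fst ℝ ℝ ℝ, ContinuousLinearMap.snd ℝ ℝ ℝ,
        fderiv ℝ (fun s : ℝ × ℝ => w s.1 s.2) s]) s := by
    refine hasFDerivAt_pi.2 fun i => ?_
    fin_cases i
    exacts [hasFDerivAt_fst, hasFDerivAt_snd, hw.hasFDerivAt]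
  rw [h.fderiv, ← fderiv_uncurry_apply hw]
  ext i
  fin_cases i <;> rfl

section Graphs

variable {φ : BaseSpace → BaseSpace} {q : BaseSpace} {w w' : ℝ → ℝ → ℝ} {τ p m r : ℝ}

theorem contDiffAt_graphPoint {s : ℝ × ℝ} (hw : ContDiffAt ℝ ∞ (fun s : ℝ × ℝ => w s.1 s.2) s) :
    ContDiffAt ℝ ∞ (graphPoint w) s := by
  refine contDiffAt_pi.2 fun i => ?_
  fin_cases i
  exacts [contDiffAt_fst, contDiffAt_snd, hw]

theorem graphPoint_eq (hwq : w (q 0) (q 1) = q 2) : graphPoint w (q 0, q 1) = q := by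
  ext i
  fin_cases i <;> simp [graphPoint, hwq]

theorem fderiv_coord_comp_graphPoint (hφ : DifferentiableAt ℝ φ q)
    (hw : DifferentiableAt ℝ (fun s : ℝ × ℝ => w s.1 s.2) (q 0, q 1))
    (hwq : w (q 0) (q 1) = q 2) (i : Fin 3) (v : ℝ × ℝ) :
    fderiv ℝ (fun s => φ (graphPoint w s) i) (q 0, q 1) v =
      v.1 * (jacobian φ q i 0 + deriv (fun t => w t (q 1)) (q 0) * jacobian φ q i 2) +
        v.2 * (jacobian φ q i 1 + deriv (w (q 0)) (q 1) * jacobian φ q i 2) := by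
  have hgraph : DifferentiableAt ℝ (graphPoint w) (q 0, q 1) := by
    refine differentiableAt_pi.2 fun i => ?_
    fin_cases i
    exacts [differentiableAt_fst, differentiableAt_snd, hw]
  have hφi : DifferentiableAt ℝ (fun y => φ y i) (graphPoint w (q 0, q 1)) := by
    rw [graphPoint_eq hwq]
    exact differentiableAt_pi.1 hφ i
  have hcomp := fderiv_comp (q 0, q 1) hφi hgraph
  rw [Function.comp_def] at hcomp
  rw [hcomp, ContinuousLinearMap.comp_apply, graphPoint_eq hwq, fderiv_graphPoint hw,
    fderiv_apply_eq_sum_pderiv, Fin.sum_univ_three]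
  simp [jacobian]
  ring

theorem exists_graph_image (hφ : ContDiffAt ℝ ∞ φ q)
    (hw : ContDiffAt ℝ ∞ (fun s : ℝ × ℝ => w s.1 s.2) (q 0, q 1)) (hwq : w (q 0) (q 1) = q 2)
    (hminor : graphMinor φ q (deriv (fun t => w t (q 1)) (q 0)) (deriv (w (q 0)) (q 1)) 0 1 ≠ 0) :
    ∃ w' : ℝ → ℝ → ℝ, ContDiffAt ℝ ∞ (fun s : ℝ × ℝ => w' s.1 s.2) (φ q 0, φ q 1) ∧
      ∀ᶠ s in 𝓝 (q 0, q 1), w' (φ (graphPoint w s) 0) (φ (graphPoint w s) 1) =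
        φ (graphPoint w s) 2 := by
  set τ := deriv (fun t => w t (q 1)) (q 0)
  set p := deriv (w (q 0)) (q 1)
  have hcoord (i : Fin 3) : ContDiffAt ℝ ∞ (fun s => φ (graphPoint w s) i) (q 0, q 1) :=
    ContDiffAt.comp (g := fun y => φ y i) (q 0, q 1)
      (by rw [graphPoint_eq hwq]; exact contDiffAt_pi.1 hφ i) (contDiffAt_graphPoint hw)
  have hderiv (i : Fin 3) := fderiv_coord_comp_graphPoint (hφ.differentiableAt (by simp))
    (hw.differentiableAt (by simp)) hwq i
  have hinj : Function.Injective
      (fderiv ℝ (fun s => (φ (graphPoint w s) 0, φ (graphPoint w s) 1)) (q 0, q 1)) := by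
    rw [DifferentiableAt.fderiv_prodMk ((hcoord 0).differentiableAt (by simp))
      ((hcoord 1).differentiableAt (by simp)), injective_iff_map_eq_zero]
    intro v hv
    obtain ⟨h0, h1⟩ := Prod.mk.inj hv
    simp only [ContinuousLinearMap.coe_coe, hderiv] at h0 h1
    rw [graphMinor] at hminor
    refine Prod.ext (mul_right_cancel₀ hminor ?_) (mul_right_cancel₀ hminor ?_)
    · simp only [Prod.fst_zero, zero_mul]
      linear_combination (jacobian φ q 1 1 + p * jacobian φ q 1 2) * h0 -
        (jacobian φ q 0 1 + p * jacobian φ q 0 2) * h1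
    · simp only [Prod.snd_zero, zero_mul]
      linear_combination (jacobian φ q 0 0 + τ * jacobian φ q 0 2) * h1 -
        (jacobian φ q 1 0 + τ * jacobian φ q 1 2) * h0
  obtain ⟨W, hW, hWg⟩ := exists_comp_eventuallyEq_of_injective_fderiv (n := ∞)
    (by simp) ((hcoord 0).prodMk (hcoord 1)) (hcoord 2) hinj
  refine ⟨fun t x => W (t, x), ?_, hWg⟩
  simpa only [graphPoint_eq hwq] using hW

theorem eventually_graph_eq_along_quadraticPath
    (hgraph : ∀ᶠ s in 𝓝 (q 0, q 1), w' (φ (graphPoint (jetPolynomial q τ p m r) s) 0)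
      (φ (graphPoint (jetPolynomial q τ p m r) s) 1) =
        φ (graphPoint (jetPolynomial q τ p m r) s) 2) (ξ η : ℝ) :
    ∀ᶠ s in 𝓝 (0 : ℝ),
      let γ := quadraticPath q ![ξ, η, τ * ξ + p * η] ![0, 0, m * ξ ^ 2 + r * η ^ 2] 0
      w' (φ (γ s) 0) (φ (γ s) 1) = φ (γ s) 2 := by
  have hline : Tendsto (fun s : ℝ => (q 0 + s * ξ, q 1 + s * η)) (𝓝 0) (𝓝 (q 0, q 1)) :=
    Continuous.tendsto' (by fun_prop) _ _ (by simp)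
  filter_upwards [hline.eventually hgraph] with s hs
  simpa only [graph_jetPolynomial_eq_quadraticPath] using hs

theorem contDiffAt_coord_comp_quadraticPath (hφ : ContDiffAt ℝ ∞ φ q) (v κ : BaseSpace)
    (i : Fin 3) : ContDiffAt ℝ ∞ (fun s => φ (quadraticPath q v κ 0 s) i) 0 :=
  ContDiffAt.comp (g := fun y => φ y i) 0
    (by rw [quadraticPath_self]; exact contDiffAt_pi.1 hφ i)
    (contDiff_quadraticPath q v κ 0).contDiffAt

theorem deriv_coord_comp_quadraticPath (hφ : ContDiffAt ℝ ∞ φ q) (ξ η : ℝ) (κ : BaseSpace)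
    (i : Fin 3) :
    deriv (fun s => φ (quadraticPath q ![ξ, η, τ * ξ + p * η] κ 0 s) i) 0 =
      ξ * (jacobian φ q i 0 + τ * jacobian φ q i 2) +
        η * (jacobian φ q i 1 + p * jacobian φ q i 2) := by
  rw [deriv_comp_quadraticPath (f := fun y => φ y i)
    ((contDiffAt_pi.1 hφ i).differentiableAt (by simp)), fderiv_apply_eq_sum_pderiv,
    Fin.sum_univ_three]
  simp only [jacobian, Matrix.of_apply, Matrix.cons_val]
  ring

theorem first_jet_of_graph_image (hφ : ContDiffAt ℝ ∞ φ q)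
    (hw' : ContDiffAt ℝ ∞ (fun s : ℝ × ℝ => w' s.1 s.2) (φ q 0, φ q 1)) {ξ η : ℝ} {κ : BaseSpace}
    (hgraph : ∀ᶠ s in 𝓝 (0 : ℝ),
      let γ := quadraticPath q ![ξ, η, τ * ξ + p * η] κ 0
      w' (φ (γ s) 0) (φ (γ s) 1) = φ (γ s) 2) :
    deriv (fun t => w' t (φ q 1)) (φ q 0) *
          (ξ * (jacobian φ q 0 0 + τ * jacobian φ q 0 2) +
            η * (jacobian φ q 0 1 + p * jacobian φ q 0 2)) +
        deriv (w' (φ q 0)) (φ q 1) *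
          (ξ * (jacobian φ q 1 0 + τ * jacobian φ q 1 2) +
            η * (jacobian φ q 1 1 + p * jacobian φ q 1 2)) =
      ξ * (jacobian φ q 2 0 + τ * jacobian φ q 2 2) +
        η * (jacobian φ q 2 1 + p * jacobian φ q 2 2) := by
  have hγ := quadraticPath_self q ![ξ, η, τ * ξ + p * η] κ 0
  have hψ := contDiffAt_coord_comp_quadraticPath hφ ![ξ, η, τ * ξ + p * η] κ
  have := deriv_eq_of_curve_in_graph
    (ψ₀ := fun s => φ (quadraticPath q ![ξ, η, τ * ξ + p * η] κ 0 s) 0)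
    (by rw [hγ]; exact hw'.differentiableAt (by simp)) ((hψ 0).differentiableAt (by simp))
    ((hψ 1).differentiableAt (by simp)) hgraph
  simpa only [deriv_coord_comp_quadraticPath hφ, hγ] using this

theorem second_jet_of_graph_image (hφ : ContDiffAt ℝ ∞ φ q)
    (hw' : ContDiffAt ℝ ∞ (fun s : ℝ × ℝ => w' s.1 s.2) (φ q 0, φ q 1)) {ξ η : ℝ} {κ : BaseSpace}
    (hgraph : ∀ᶠ s in 𝓝 (0 : ℝ),
      let γ := quadraticPath q ![ξ, η, τ * ξ + p * η] κ 0
      w' (φ (γ s) 0) (φ (γ s) 1) = φ (γ s) 2)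
    (htime : ξ * (jacobian φ q 0 0 + τ * jacobian φ q 0 2) +
      η * (jacobian φ q 0 1 + p * jacobian φ q 0 2) = 0) :
    let S := secondVariation φ q ![ξ, η, τ * ξ + p * η] κ
    deriv (deriv (w' (φ q 0))) (φ q 1) *
          (ξ * (jacobian φ q 1 0 + τ * jacobian φ q 1 2) +
            η * (jacobian φ q 1 1 + p * jacobian φ q 1 2)) ^ 2 +
        deriv (fun t => w' t (φ q 1)) (φ q 0) * S 0 + deriv (w' (φ q 0)) (φ q 1) * S 1 = S 2 := by
  have hγ := quadraticPath_self q ![ξ, η, τ * ξ + p * η] κ 0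
  have hψ := contDiffAt_coord_comp_quadraticPath hφ ![ξ, η, τ * ξ + p * η] κ
  have hψ' (i : Fin 3) := deriv_deriv_comp_quadraticPath
    ((contDiffAt_pi.1 hφ i).of_le two_le_infty) ![ξ, η, τ * ξ + p * η] κ 0
  have := deriv_deriv_eq_of_curve_in_graph
    (ψ₀ := fun s => φ (quadraticPath q ![ξ, η, τ * ξ + p * η] κ 0 s) 0)
    (by rw [hγ]; exact hw'.of_le two_le_infty) ((hψ 0).of_le two_le_infty)
    ((hψ 1).of_le two_le_infty) (by rw [deriv_coord_comp_quadraticPath hφ, htime]) hgraph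
  simpa only [deriv_coord_comp_quadraticPath hφ, hγ, hψ', secondVariation] using this

theorem CarriesEquationAt.jet_identity {D K D' K' : ℝ → ℝ}
    (h : CarriesEquationAt φ D K D' K' q) (hφ : ContDiffAt ℝ ∞ φ q)
    (hD : DifferentiableAt ℝ D (q 2)) (hD' : DifferentiableAt ℝ D' (φ q 2))
    (hminor : graphMinor φ q τ p 0 1 ≠ 0)
    (hjet : τ = D (q 2) * r + deriv D (q 2) * p ^ 2 + K (q 2) * p) {ξ η : ℝ}
    (hξ : ξ = -(jacobian φ q 0 1 + p * jacobian φ q 0 2))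
    (hη : η = jacobian φ q 0 0 + τ * jacobian φ q 0 2) :
    let S := secondVariation φ q ![ξ, η, τ * ξ + p * η] ![0, 0, m * ξ ^ 2 + r * η ^ 2]
    let Δ := graphMinor φ q τ p
    Δ 2 1 * Δ 0 1 ^ 2 = D' (φ q 2) * (Δ 0 1 * S 2 - Δ 2 1 * S 0 - Δ 0 2 * S 1) +
      deriv D' (φ q 2) * Δ 0 2 ^ 2 * Δ 0 1 + K' (φ q 2) * Δ 0 2 * Δ 0 1 ^ 2 := by
  have hself := jetPolynomial_self q τ p m r
  have hw := contDiff_jetPolynomial q τ p m r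
  obtain ⟨w', hw', hgraph⟩ := exists_graph_image hφ hw.contDiffAt hself
    (by rwa [deriv_jetPolynomial_left, deriv_jetPolynomial_right])
  have hsat := (h _ w' hw.contDiffAt hself hw' hgraph).1
    ((satisfiesAt_jetPolynomial_iff q τ p m r hD).2 hjet)
  have hcurve := eventually_graph_eq_along_quadraticPath hgraph
  have hdtime := first_jet_of_graph_image hφ hw' (hcurve (jacobian φ q 1 1 + p * jacobian φ q 1 2)
    (-(jacobian φ q 1 0 + τ * jacobian φ q 1 2)))
  have hdspace := first_jet_of_graph_image hφ hw' (hcurve ξ η)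
  have hd2space := second_jet_of_graph_image hφ hw' (hcurve ξ η) (by rw [hξ, hη]; ring)
  have hself' : w' (φ q 0) (φ q 1) = φ q 2 := by
    simpa only [graphPoint_eq hself] using hgraph.self_of_nhds
  rw [satisfiesAt_iff ?_ (by rwa [hself']), hself'] at hsat
  · have hN : deriv (w' (φ q 0)) (φ q 1) * graphMinor φ q τ p 0 1 = graphMinor φ q τ p 0 2 := by
      rw [hξ, hη] at hdspace
      simp only [graphMinor]
      linear_combination hdspace
    have hM : deriv (fun t => w' t (φ q 1)) (φ q 0) * graphMinor φ q τ p 0 1 =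
        graphMinor φ q τ p 2 1 := by
      simp only [graphMinor]
      linear_combination hdtime
    have hΔ : ξ * (jacobian φ q 1 0 + τ * jacobian φ q 1 2) +
        η * (jacobian φ q 1 1 + p * jacobian φ q 1 2) = graphMinor φ q τ p 0 1 := by
      simp only [hξ, hη, graphMinor]
      ring
    rw [hΔ] at hd2space
    dsimp only at hd2space ⊢
    rw [← hM, ← hN, ← hd2space]
    linear_combination graphMinor φ q τ p 0 1 ^ 3 * hsat
  · exact (hw'.comp (φ q 1) (contDiffAt_const.prodMk contDiffAt_id)).of_le two_le_infty

end Graphs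

/-- The point transformation `φ` is smooth and nonsingular at `q`, and it carries over `q` the
equation with the coefficients `(D, K)` to the equation with the coefficients `(D', K')`, where `D`
and `D'` are smooth and do not vanish at the relevant points. In contrast to the class under
consideration, the equations may be linear, which makes this condition stable under small changes
of `q`. -/
structure TransformsEquationAt (φ : BaseSpace → BaseSpace) (D K D' K' : ℝ → ℝ) (q : BaseSpace) :
    Prop where
  smooth : ContDiffAt ℝ ∞ φ q
  nonsingular : NonsingularAt φ q
  smooth_source : ContDiffAt ℝ ∞ D (q 2)
  ne_zero_source : D (q 2) ≠ 0
  smooth_target : ContDiffAt ℝ ∞ D' (φ q 2)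
  ne_zero_target : D' (φ q 2) ≠ 0
  carries : CarriesEquationAt φ D K D' K' q

section DeterminingEquations

variable {φ : BaseSpace → BaseSpace} {D K D' K' : ℝ → ℝ} {q : BaseSpace}

theorem det_jacobian_eq_graphMinor (φ : BaseSpace → BaseSpace) (q : BaseSpace) (τ p : ℝ) :
    (jacobian φ q).det = graphMinor φ q τ p 0 1 * jacobian φ q 2 2 -
      graphMinor φ q τ p 2 1 * jacobian φ q 0 2 - graphMinor φ q τ p 0 2 * jacobian φ q 1 2 := by
  simp only [Matrix.det_fin_three, graphMinor]
  ring

theorem secondVariation_vertical (φ : BaseSpace → BaseSpace) (q v : BaseSpace) (k : ℝ)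
    (i : Fin 3) :
    secondVariation φ q v ![0, 0, k] i =
      fderiv ℝ (fderiv ℝ fun y => φ y i) q v v + k * jacobian φ q i 2 := by
  rw [secondVariation, fderiv_apply_eq_sum_pderiv _ _ ![0, 0, k], Fin.sum_univ_three]
  simp [jacobian]

theorem eq_zero_of_forall_affine_mul_affine_eq_zero {a b c e f : ℝ}
    (h : ∀ τ p : ℝ, (a + b * τ + c * p) * (e + f * p) = 0) (hne : ¬(a = 0 ∧ b = 0 ∧ c = 0)) :
    e = 0 ∧ f = 0 := by
  have hae : a * e = 0 := by linear_combination h 0 0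
  have hbe : b * e = 0 := by linear_combination h 1 0 - h 0 0
  have hcf : c * f = 0 := by linear_combination (h 0 1 + h 0 (-1)) / 2 - h 0 0
  have hcross : a * f + c * e = 0 := by linear_combination (h 0 1 - h 0 (-1)) / 2
  have hbf : b * f = 0 := by linear_combination h 1 1 - h 0 1 - h 1 0 + h 0 0
  grind

namespace TransformsEquationAt

theorem det_jacobian_ne_zero (h : TransformsEquationAt φ D K D' K' q) : (jacobian φ q).det ≠ 0 :=
  (nonsingularAt_iff_det_jacobian_ne_zero (h.smooth.differentiableAt (by simp))).1 h.nonsingular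

theorem jet_identity (h : TransformsEquationAt φ D K D' K' q) {τ p r : ℝ} (m : ℝ)
    (hminor : graphMinor φ q τ p 0 1 ≠ 0)
    (hjet : τ = D (q 2) * r + deriv D (q 2) * p ^ 2 + K (q 2) * p) {ξ η : ℝ}
    (hξ : ξ = -(jacobian φ q 0 1 + p * jacobian φ q 0 2))
    (hη : η = jacobian φ q 0 0 + τ * jacobian φ q 0 2) :
    let S := secondVariation φ q ![ξ, η, τ * ξ + p * η] ![0, 0, m * ξ ^ 2 + r * η ^ 2]
    let Δ := graphMinor φ q τ p
    Δ 2 1 * Δ 0 1 ^ 2 = D' (φ q 2) * (Δ 0 1 * S 2 - Δ 2 1 * S 0 - Δ 0 2 * S 1) +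
      deriv D' (φ q 2) * Δ 0 2 ^ 2 * Δ 0 1 + K' (φ q 2) * Δ 0 2 * Δ 0 1 ^ 2 :=
  h.carries.jet_identity h.smooth (h.smooth_source.differentiableAt (by simp))
    (h.smooth_target.differentiableAt (by simp)) hminor hjet hξ hη

theorem exists_jet (h : TransformsEquationAt φ D K D' K' q) (τ p : ℝ) :
    ∃ r, τ = D (q 2) * r + deriv D (q 2) * p ^ 2 + K (q 2) * p :=
  ⟨(τ - deriv D (q 2) * p ^ 2 - K (q 2) * p) / D (q 2), by field_simp [h.ne_zero_source]; ring⟩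

/-- The second `t`-derivative of a solution is not constrained by the equation, so it must not
enter the transformed equation. -/
theorem graphMinor_mul_eq_zero (h : TransformsEquationAt φ D K D' K' q) (τ p : ℝ) :
    graphMinor φ q τ p 0 1 * (jacobian φ q 0 1 + p * jacobian φ q 0 2) = 0 := by
  by_contra hne
  obtain ⟨hminor, hξ⟩ := mul_ne_zero_iff.1 hne
  obtain ⟨r, hr⟩ := h.exists_jet τ p
  have h0 := h.jet_identity 0 hminor hr rfl rfl
  have h1 := h.jet_identity 1 hminor hr rfl rfl
  simp only [secondVariation_vertical] at h0 h1
  refine mul_ne_zero (mul_ne_zero h.ne_zero_target h.det_jacobian_ne_zero) (pow_ne_zero 2 hξ) ?_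
  rw [det_jacobian_eq_graphMinor φ q τ p]
  linear_combination h0 - h1

theorem jacobian_time_eq_zero (h : TransformsEquationAt φ D K D' K' q) :
    jacobian φ q 0 1 = 0 ∧ jacobian φ q 0 2 = 0 := by
  refine eq_zero_of_forall_affine_mul_affine_eq_zero
    (a := graphMinor φ q 0 0 0 1) (b := graphMinor φ q 1 0 0 1 - graphMinor φ q 0 0 0 1)
    (c := graphMinor φ q 0 1 0 1 - graphMinor φ q 0 0 0 1) (fun τ p => ?_) fun hzero => ?_
  · refine Eq.trans ?_ (h.graphMinor_mul_eq_zero τ p)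
    simp only [graphMinor]
    ring
  · obtain ⟨ha, hb, hc⟩ := hzero
    refine h.det_jacobian_ne_zero ?_
    simp only [graphMinor] at ha hb hc
    rw [Matrix.det_fin_three]
    linear_combination jacobian φ q 2 2 * ha - jacobian φ q 2 0 * hb - jacobian φ q 2 1 * hc

end TransformsEquationAt

/-- The second total `x`-derivative of the `i`-th component of `φ` on the graph of a function with
`u_x = p` and `u_xx = r`. -/
noncomputable def totalDerivXX (φ : BaseSpace → BaseSpace) (q : BaseSpace) (p r : ℝ) (i : Fin 3) :
    ℝ :=
  pderiv 1 (pderiv 1 fun y => φ y i) q + 2 * p * pderiv 1 (pderiv 2 fun y => φ y i) q +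
    p ^ 2 * pderiv 2 (pderiv 2 fun y => φ y i) q + r * jacobian φ q i 2

theorem secondVariation_eq_totalDerivXX (hφ : ContDiffAt ℝ ∞ φ q) (p r η : ℝ) (i : Fin 3) :
    secondVariation φ q ![0, η, p * η] ![0, 0, r * η ^ 2] i = η ^ 2 * totalDerivXX φ q p r i := by
  have hφi := (contDiffAt_pi.1 hφ i).of_le two_le_infty
  rw [secondVariation_vertical, fderiv_fderiv_apply_eq_sum_pderiv hφi, totalDerivXX]
  simp only [Fin.sum_univ_three, Matrix.cons_val, pderiv_comm hφi 2 1]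
  ring

namespace TransformsEquationAt

theorem totalDerivXX_time_eq_zero (h : ∀ᶠ y in 𝓝 q, TransformsEquationAt φ D K D' K' y)
    (p r : ℝ) : totalDerivXX φ q p r 0 = 0 := by
  have hx := pderiv_pderiv_eq_zero_of_jacobian_eq_zero
    (h.mono fun _ hy => hy.jacobian_time_eq_zero.1)
  have hu := pderiv_pderiv_eq_zero_of_jacobian_eq_zero
    (h.mono fun _ hy => hy.jacobian_time_eq_zero.2)
  rw [totalDerivXX, hx, hu, hu, h.self_of_nhds.jacobian_time_eq_zero.2]
  ring

theorem det_jacobian_eq (h : TransformsEquationAt φ D K D' K' q) :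
    (jacobian φ q).det = jacobian φ q 0 0 *
      (jacobian φ q 1 1 * jacobian φ q 2 2 - jacobian φ q 2 1 * jacobian φ q 1 2) := by
  rw [Matrix.det_fin_three, h.jacobian_time_eq_zero.1, h.jacobian_time_eq_zero.2]
  ring

theorem jacobian_time_time_ne_zero (h : TransformsEquationAt φ D K D' K' q) :
    jacobian φ q 0 0 ≠ 0 :=
  left_ne_zero_of_mul (h.det_jacobian_eq ▸ h.det_jacobian_ne_zero)

theorem jet_identity_of_eventually (h : ∀ᶠ y in 𝓝 q, TransformsEquationAt φ D K D' K' y)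
    {τ p r d n : ℝ} (hjet : τ = D (q 2) * r + deriv D (q 2) * p ^ 2 + K (q 2) * p)
    (hd : d = jacobian φ q 1 1 + p * jacobian φ q 1 2)
    (hn : n = jacobian φ q 2 1 + p * jacobian φ q 2 2) (hd0 : d ≠ 0) :
    ((jacobian φ q 2 0 + τ * jacobian φ q 2 2) * d -
        (jacobian φ q 1 0 + τ * jacobian φ q 1 2) * n) * d ^ 2 =
      jacobian φ q 0 0 * (D' (φ q 2) * (d * totalDerivXX φ q p r 2 - n * totalDerivXX φ q p r 1) +
        deriv D' (φ q 2) * n ^ 2 * d + K' (φ q 2) * n * d ^ 2) := by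
  have hq := h.self_of_nhds
  have hT := hq.jacobian_time_time_ne_zero
  obtain ⟨hx, hu⟩ := hq.jacobian_time_eq_zero
  have hminor (i : Fin 3) : graphMinor φ q τ p 0 i =
      jacobian φ q 0 0 * (jacobian φ q i 1 + p * jacobian φ q i 2) := by
    rw [graphMinor, hx, hu]
    ring
  have := hq.jet_identity 0 (by rw [hminor, ← hd]; exact mul_ne_zero hT hd0) hjet
    (ξ := 0) (η := jacobian φ q 0 0) (by rw [hx, hu]; ring) (by rw [hu]; ring)
  simp only [hminor, ← hd, ← hn, mul_zero, zero_add, ne_eq, OfNat.ofNat_ne_zero, not_false_eq_true,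
    zero_pow, secondVariation_eq_totalDerivXX hq.smooth, totalDerivXX_time_eq_zero h] at this
  refine mul_left_cancel₀ (pow_ne_zero 2 hT) (Eq.trans ?_ (this.trans ?_))
  · rw [hd, hn, graphMinor]
    ring
  · ring

theorem diffusion_eq_of_ne_zero (h : ∀ᶠ y in 𝓝 q, TransformsEquationAt φ D K D' K' y) {p : ℝ}
    (hp : jacobian φ q 1 1 + p * jacobian φ q 1 2 ≠ 0) :
    D' (φ q 2) * jacobian φ q 0 0 =
      D (q 2) * (jacobian φ q 1 1 + p * jacobian φ q 1 2) ^ 2 := by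
  have h0 := jet_identity_of_eventually h (p := p) (r := 0) rfl rfl rfl hp
  have h1 := jet_identity_of_eventually h (p := p) (r := 1) rfl rfl rfl hp
  have hJ := right_ne_zero_of_mul
    (h.self_of_nhds.det_jacobian_eq ▸ h.self_of_nhds.det_jacobian_ne_zero)
  simp only [totalDerivXX] at h0 h1
  refine mul_right_cancel₀ hJ ?_
  linear_combination h0 - h1

theorem jacobian_space_value_eq_zero
    (h : ∀ᶠ y in 𝓝 q, TransformsEquationAt φ D K D' K' y) : jacobian φ q 1 2 = 0 := by
  by_contra hne
  have hp (d : ℝ) : jacobian φ q 1 1 + (d - jacobian φ q 1 1) / jacobian φ q 1 2 *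
      jacobian φ q 1 2 = d := by
    field_simp
    ring
  have h1 := diffusion_eq_of_ne_zero h (p := (1 - jacobian φ q 1 1) / jacobian φ q 1 2)
    (by rw [hp]; norm_num)
  have h2 := diffusion_eq_of_ne_zero h (p := (2 - jacobian φ q 1 1) / jacobian φ q 1 2)
    (by rw [hp]; norm_num)
  rw [hp] at h1 h2
  exact h.self_of_nhds.ne_zero_source (by linarith)

theorem jacobian_space_space_ne_zero (h : ∀ᶠ y in 𝓝 q, TransformsEquationAt φ D K D' K' y) :
    jacobian φ q 1 1 ≠ 0 ∧ jacobian φ q 2 2 ≠ 0 := by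
  have hdet := h.self_of_nhds.det_jacobian_ne_zero
  rw [h.self_of_nhds.det_jacobian_eq, jacobian_space_value_eq_zero h] at hdet
  constructor <;> rintro hzero <;> simp [hzero] at hdet

theorem diffusion_eq (h : ∀ᶠ y in 𝓝 q, TransformsEquationAt φ D K D' K' y) :
    D' (φ q 2) * jacobian φ q 0 0 = D (q 2) * jacobian φ q 1 1 ^ 2 := by
  have hp : jacobian φ q 1 1 + 0 * jacobian φ q 1 2 ≠ 0 := by
    simpa using (jacobian_space_space_ne_zero h).1
  simpa using diffusion_eq_of_ne_zero h hp

theorem pderiv_pderiv_time_eq_zero (h : ∀ᶠ y in 𝓝 q, TransformsEquationAt φ D K D' K' y)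
    {j : Fin 3} (hj : j ≠ 0) : pderiv j (pderiv 0 fun y => φ y 0) q = 0 := by
  rw [pderiv_comm ((contDiffAt_pi.1 h.self_of_nhds.smooth 0).of_le two_le_infty)]
  refine pderiv_pderiv_eq_zero_of_jacobian_eq_zero (h.mono fun y hy => ?_) 0
  fin_cases j
  exacts [absurd rfl hj, hy.jacobian_time_eq_zero.1, hy.jacobian_time_eq_zero.2]

theorem pderiv_diffusion_eq (h : ∀ᶠ y in 𝓝 q, TransformsEquationAt φ D K D' K' y) {j : Fin 3}
    (hj : j ≠ 0) :
    deriv D' (φ q 2) * jacobian φ q 2 j * jacobian φ q 0 0 =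
      deriv D (q 2) * (if 2 = j then 1 else 0) * jacobian φ q 1 1 ^ 2 +
        2 * D (q 2) * jacobian φ q 1 1 * pderiv j (pderiv 1 fun y => φ y 1) q := by
  have hq := h.self_of_nhds
  have hφ (i : Fin 3) := contDiffAt_pi.1 hq.smooth i
  have hJ (i k : Fin 3) : DifferentiableAt ℝ (fun y => jacobian φ y i k) q :=
    differentiableAt_pderiv ((hφ i).of_le two_le_infty) k
  have hD := hq.smooth_source.differentiableAt (by simp)
  have hD' := hq.smooth_target.differentiableAt (by simp)
  have hφ2 := (hφ 2).differentiableAt (by simp)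
  have heq : pderiv j (fun y => D' (φ y 2) * jacobian φ y 0 0) q =
      pderiv j (fun y => D (y 2) * (jacobian φ y 1 1 * jacobian φ y 1 1)) q := by
    have : (fun y => D' (φ y 2) * jacobian φ y 0 0) =ᶠ[𝓝 q]
        fun y => D (y 2) * (jacobian φ y 1 1 * jacobian φ y 1 1) :=
      h.eventually_nhds.mono fun y hy => (diffusion_eq hy).trans (by ring)
    rw [pderiv, pderiv, this.fderiv_eq]
  rw [pderiv_mul (f := fun y => D' (φ y 2)) (by fun_prop) (hJ 0 0),
    pderiv_mul (f := fun y => D (y 2)) (by fun_prop) ((hJ 1 1).fun_mul (hJ 1 1)),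
    pderiv_mul (hJ 1 1) (hJ 1 1), pderiv_comp hD' hφ2, pderiv_comp hD (by fun_prop),
    pderiv_coord] at heq
  have hT : pderiv j (fun y => jacobian φ y 0 0) q = 0 := pderiv_pderiv_time_eq_zero h hj
  rw [hT, mul_zero, zero_add] at heq
  change _ * (_ * jacobian φ q 2 j) = _ at heq
  change _ = _ + _ * pderiv j (fun y => jacobian φ y 1 1) q
  linear_combination heq

theorem pderiv_pderiv_space_eq_zero (h : ∀ᶠ y in 𝓝 q, TransformsEquationAt φ D K D' K' y)
    (j : Fin 3) : pderiv j (pderiv 2 fun y => φ y 1) q = 0 :=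
  pderiv_pderiv_eq_zero_of_jacobian_eq_zero
    (h.eventually_nhds.mono fun _ hy => jacobian_space_value_eq_zero hy) j

theorem deriv_diffusion_eq (h : ∀ᶠ y in 𝓝 q, TransformsEquationAt φ D K D' K' y) :
    deriv D' (φ q 2) * jacobian φ q 2 2 * jacobian φ q 0 0 =
      deriv D (q 2) * jacobian φ q 1 1 ^ 2 := by
  have hX := pderiv_comm ((contDiffAt_pi.1 h.self_of_nhds.smooth 1).of_le two_le_infty) 2 1
  rw [pderiv_pderiv_space_eq_zero h 1] at hX
  simpa only [hX, if_pos, mul_one, mul_zero, add_zero] using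
    pderiv_diffusion_eq h (j := 2) (by decide)

/-- Only jets with `u_xx = 0` enter, which makes the identity polynomial in `p = u_x`. -/
theorem jet_polynomial_identity (h : ∀ᶠ y in 𝓝 q, TransformsEquationAt φ D K D' K' y) (p : ℝ) :
    ((jacobian φ q 2 0 + (deriv D (q 2) * p ^ 2 + K (q 2) * p) * jacobian φ q 2 2) *
        jacobian φ q 1 1 - jacobian φ q 1 0 * (jacobian φ q 2 1 + p * jacobian φ q 2 2)) *
          jacobian φ q 1 1 ^ 2 =
      jacobian φ q 0 0 * (D' (φ q 2) * (jacobian φ q 1 1 *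
            (pderiv 1 (pderiv 1 fun y => φ y 2) q + 2 * p * pderiv 1 (pderiv 2 fun y => φ y 2) q +
              p ^ 2 * pderiv 2 (pderiv 2 fun y => φ y 2) q) -
          (jacobian φ q 2 1 + p * jacobian φ q 2 2) * pderiv 1 (pderiv 1 fun y => φ y 1) q) +
        deriv D' (φ q 2) * (jacobian φ q 2 1 + p * jacobian φ q 2 2) ^ 2 * jacobian φ q 1 1 +
        K' (φ q 2) * (jacobian φ q 2 1 + p * jacobian φ q 2 2) * jacobian φ q 1 1 ^ 2) := by
  have hX := jacobian_space_value_eq_zero h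
  have := jet_identity_of_eventually h (p := p) (r := 0) rfl (d := jacobian φ q 1 1)
    (by rw [hX]; ring) rfl (jacobian_space_space_ne_zero h).1
  simp only [totalDerivXX, hX, pderiv_pderiv_space_eq_zero h] at this
  linear_combination this

theorem pderiv_pderiv_value_eq_zero (h : ∀ᶠ y in 𝓝 q, TransformsEquationAt φ D K D' K' y) :
    pderiv 2 (pderiv 2 fun y => φ y 2) q = 0 := by
  have hq := h.self_of_nhds
  have hne : jacobian φ q 0 0 * D' (φ q 2) * jacobian φ q 1 1 ≠ 0 :=
    mul_ne_zero (mul_ne_zero hq.jacobian_time_time_ne_zero hq.ne_zero_target)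
      (jacobian_space_space_ne_zero h).1
  refine (mul_eq_zero.1 ?_).resolve_left hne
  linear_combination (2 * jet_polynomial_identity h 0 - jet_polynomial_identity h 1 -
    jet_polynomial_identity h (-1)) / 2 -
    jacobian φ q 2 2 * jacobian φ q 1 1 * deriv_diffusion_eq h

theorem pderiv_pderiv_space_space_eq_zero
    (h : ∀ᶠ y in 𝓝 q, TransformsEquationAt φ D K D' K' y) (hU : jacobian φ q 2 1 = 0) :
    pderiv 1 (pderiv 1 fun y => φ y 1) q = 0 := by
  have hne : 2 * D (q 2) * jacobian φ q 1 1 ≠ 0 :=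
    mul_ne_zero (mul_ne_zero two_ne_zero h.self_of_nhds.ne_zero_source)
      (jacobian_space_space_ne_zero h).1
  refine (mul_eq_zero.1 ?_).resolve_left hne
  simpa [hU] using (pderiv_diffusion_eq h one_ne_zero).symm

theorem convection_eq (h : ∀ᶠ y in 𝓝 q, TransformsEquationAt φ D K D' K' y)
    (hU : ∀ᶠ y in 𝓝 q, jacobian φ y 2 1 = 0) :
    K' (φ q 2) * jacobian φ q 0 0 = K (q 2) * jacobian φ q 1 1 - jacobian φ q 1 0 := by
  have hU0 := hU.self_of_nhds
  have hUux := pderiv_comm ((contDiffAt_pi.1 h.self_of_nhds.smooth 2).of_le two_le_infty) 2 1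
  rw [pderiv_pderiv_eq_zero_of_jacobian_eq_zero hU 2] at hUux
  obtain ⟨hX, hU'⟩ := jacobian_space_space_ne_zero h
  have hne : jacobian φ q 2 2 * jacobian φ q 1 1 ^ 2 ≠ 0 := mul_ne_zero hU' (pow_ne_zero 2 hX)
  have h1 := jet_polynomial_identity h 1
  have h2 := jet_polynomial_identity h (-1)
  rw [hU0, ← hUux, pderiv_pderiv_space_space_eq_zero h hU0] at h1 h2
  refine mul_left_cancel₀ hne ?_
  linear_combination (h2 - h1) / 2

end TransformsEquationAt

end DeterminingEquations

end PointTransformations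

section LiftedMaps

variable {D K : ℝ → ℝ} {q : BaseSpace}

theorem fderiv_liftPoint (hD : DifferentiableAt ℝ D (q 2)) (hK : DifferentiableAt ℝ K (q 2))
    (v : BaseSpace) :
    fderiv ℝ (liftPoint D K) q v =
      ![v 0, v 1, v 2, deriv D (q 2) * v 2, deriv K (q 2) * v 2] := by
  let coord (i : Fin 3) : BaseSpace →L[ℝ] ℝ := ContinuousLinearMap.proj i
  have hcoord (i : Fin 3) : HasFDerivAt (fun y : BaseSpace => y i) (coord i) q :=
    hasFDerivAt_apply i q
  have h : HasFDerivAt (liftPoint D K) (ContinuousLinearMap.pi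
      ![coord 0, coord 1, coord 2, deriv D (q 2) • coord 2, deriv K (q 2) • coord 2]) q := by
    refine hasFDerivAt_pi.2 fun i => ?_
    fin_cases i
    exacts [hcoord 0, hcoord 1, hcoord 2, hD.hasDerivAt.comp_hasFDerivAt q (hcoord 2),
      hK.hasDerivAt.comp_hasFDerivAt q (hcoord 2)]
  rw [h.fderiv]
  ext i
  fin_cases i <;> rfl

theorem contDiffAt_liftPoint (hD : ContDiffAt ℝ ∞ D (q 2)) (hK : ContDiffAt ℝ ∞ K (q 2)) :
    ContDiffAt ℝ ∞ (liftPoint D K) q := by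
  have hcoord (i : Fin 3) : ContDiffAt ℝ ∞ (fun y : BaseSpace => y i) q :=
    (contDiff_apply ℝ ℝ i).contDiffAt
  have hD' : ContDiffAt ℝ ∞ (fun y : BaseSpace => D (y 2)) q := hD.comp q (hcoord 2)
  have hK' : ContDiffAt ℝ ∞ (fun y : BaseSpace => K (y 2)) q := hK.comp q (hcoord 2)
  refine contDiffAt_pi.2 fun i => ?_
  fin_cases i
  exacts [hcoord 0, hcoord 1, hcoord 2, hD', hK']

/-- The Jacobian matrix of the first three components of `Φ` with respect to `(t, x, u)`, where
`D` and `K` depend on `u` with the slopes `s`. -/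
noncomputable def slopeJacobian (Φ : ExtSpace → ExtSpace) (z : ExtSpace) (s : ℝ × ℝ) :
    Matrix (Fin 3) (Fin 3) ℝ :=
  Matrix.of fun i => let J := jacobian Φ z (i.castLE (by decide))
    ![J 0, J 1, J 2 + s.1 * J 3 + s.2 * J 4]

theorem pderiv_comp_liftPoint {f : ExtSpace → ℝ} (hf : DifferentiableAt ℝ f (liftPoint D K q))
    (hD : ContDiffAt ℝ ∞ D (q 2)) (hK : ContDiffAt ℝ ∞ K (q 2)) (j : Fin 3) :
    pderiv j (fun y => f (liftPoint D K y)) q =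
      ![pderiv 0 f (liftPoint D K q), pderiv 1 f (liftPoint D K q),
        pderiv 2 f (liftPoint D K q) + deriv D (q 2) * pderiv 3 f (liftPoint D K q) +
          deriv K (q 2) * pderiv 4 f (liftPoint D K q)] j := by
  have := fderiv_comp q hf ((contDiffAt_liftPoint hD hK).differentiableAt (by simp))
  rw [Function.comp_def] at this
  rw [pderiv, this, ContinuousLinearMap.comp_apply, fderiv_liftPoint
    (hD.differentiableAt (by simp)) (hK.differentiableAt (by simp)), fderiv_apply_eq_sum_pderiv,
    Fin.sum_univ_five]
  fin_cases j <;> simp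

theorem inducedMap_apply (Φ : ExtSpace → ExtSpace) (q : BaseSpace) (i : Fin 3) :
    inducedMap Φ D K q i = Φ (liftPoint D K q) (i.castLE (by decide)) := by
  fin_cases i <;> rfl

theorem jacobian_inducedMap {Φ : ExtSpace → ExtSpace}
    (hΦ : DifferentiableAt ℝ Φ (liftPoint D K q)) (hD : ContDiffAt ℝ ∞ D (q 2))
    (hK : ContDiffAt ℝ ∞ K (q 2)) :
    jacobian (inducedMap Φ D K) q =
      slopeJacobian Φ (liftPoint D K q) (deriv D (q 2), deriv K (q 2)) := by
  ext i j
  simp only [jacobian, slopeJacobian, Matrix.of_apply, inducedMap_apply]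
  exact pderiv_comp_liftPoint (differentiableAt_pi.1 hΦ _) hD hK j

theorem contDiffAt_inducedMap {Φ : ExtSpace → ExtSpace} (hΦ : ContDiffAt ℝ ∞ Φ (liftPoint D K q))
    (hD : ContDiffAt ℝ ∞ D (q 2)) (hK : ContDiffAt ℝ ∞ K (q 2)) :
    ContDiffAt ℝ ∞ (inducedMap Φ D K) q := by
  refine contDiffAt_pi.2 fun i => ?_
  simp only [inducedMap_apply]
  exact (contDiffAt_pi.1 hΦ _).comp q (contDiffAt_liftPoint hD hK)

theorem slopeJacobian_apply_of_ne {j : Fin 3} (hj : j ≠ 2) (Φ : ExtSpace → ExtSpace) (z : ExtSpace)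
    (s : ℝ × ℝ) (i : Fin 3) :
    slopeJacobian Φ z s i j =
      jacobian Φ z (i.castLE (by decide)) (j.castLE (by decide)) := by
  fin_cases j
  exacts [rfl, rfl, absurd rfl hj]

theorem jacobian_eq_deriv_mul_jacobian {Φ : ExtSpace → ExtSpace} {g : ℝ → ℝ} {i : Fin 5}
    (hΦ : ContDiffAt ℝ ∞ Φ (liftPoint D K q)) (hD : ContDiffAt ℝ ∞ D (q 2))
    (hK : ContDiffAt ℝ ∞ K (q 2)) (hg : DifferentiableAt ℝ g (inducedMap Φ D K q 2))
    (h : ∀ᶠ y in 𝓝 q, Φ (liftPoint D K y) i = g (inducedMap Φ D K y 2)) {j : Fin 3}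
    (hj : j ≠ 2) :
    jacobian Φ (liftPoint D K q) i (j.castLE (by decide)) =
      deriv g (inducedMap Φ D K q 2) *
        jacobian Φ (liftPoint D K q) 2 (j.castLE (by decide)) := by
  have hΦd := hΦ.differentiableAt (by simp)
  have hφ := (contDiffAt_inducedMap hΦ hD hK).differentiableAt (by simp)
  have h' : (fun y => Φ (liftPoint D K y) i) =ᶠ[𝓝 q] fun y => g (inducedMap Φ D K y 2) := h
  have hlift := pderiv_comp_liftPoint (differentiableAt_pi.1 hΦd i) hD hK j
  rw [pderiv, h'.fderiv_eq, ← pderiv, pderiv_comp hg (differentiableAt_pi.1 hφ 2)] at hlift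
  change _ * jacobian (inducedMap Φ D K) q 2 j = _ at hlift
  rw [jacobian_inducedMap hΦd hD hK, slopeJacobian_apply_of_ne hj] at hlift
  refine Eq.trans ?_ hlift.symm
  fin_cases j
  exacts [rfl, rfl, absurd rfl hj]

end LiftedMaps

section AdmissibleSlopes

/-- The slopes `(D_u, K_u)` with `D_u ≠ 0` for which the map of `(t, x, u)` induced by `Φ` is
nonsingular at the point under `z`. -/
def admissibleSlopes (Φ : ExtSpace → ExtSpace) (z : ExtSpace) : Set (ℝ × ℝ) :=
  {s | s.1 ≠ 0 ∧ (slopeJacobian Φ z s).det ≠ 0}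

theorem continuous_det_slopeJacobian (Φ : ExtSpace → ExtSpace) (z : ExtSpace) :
    Continuous fun s => (slopeJacobian Φ z s).det := by
  refine Continuous.matrix_det (continuous_pi fun i => continuous_pi fun j => ?_)
  fin_cases j <;> dsimp only [slopeJacobian, Matrix.of_apply] <;> fun_prop

theorem isOpen_admissibleSlopes (Φ : ExtSpace → ExtSpace) (z : ExtSpace) :
    IsOpen (admissibleSlopes Φ z) :=
  (isOpen_ne_fun continuous_fst continuous_const).inter
    (isOpen_ne_fun (continuous_det_slopeJacobian Φ z) continuous_const)

theorem eq_zero_of_forall_mem_affine_eq_zero {S : Set (ℝ × ℝ)} (hS : IsOpen S) (hS' : S.Nonempty)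
    {a b c : ℝ} (h : ∀ s ∈ S, a + s.1 * b + s.2 * c = 0) : a = 0 ∧ b = 0 ∧ c = 0 := by
  obtain ⟨s, hs⟩ := hS'
  have hdir (v : ℝ × ℝ) : ∃ r : ℝ, r ≠ 0 ∧ s + r • v ∈ S := by
    have hline : Tendsto (fun r : ℝ => s + r • v) (𝓝[≠] 0) (𝓝 s) :=
      (Continuous.tendsto' (by fun_prop) _ _ (by simp)).mono_left nhdsWithin_le_nhds
    obtain ⟨r, hr, hr'⟩ := ((hline.eventually (hS.mem_nhds hs)).and self_mem_nhdsWithin).exists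
    exact ⟨r, hr', hr⟩
  obtain ⟨r, hr, hrS⟩ := hdir (1, 0)
  obtain ⟨r', hr', hrS'⟩ := hdir (0, 1)
  have h0 := h s hs
  have h1 := h _ hrS
  have h2 := h _ hrS'
  simp only [Prod.fst_add, Prod.snd_add, Prod.smul_fst, Prod.smul_snd, smul_eq_mul, mul_one,
    mul_zero, add_zero] at h1 h2
  have hb : b = 0 := mul_left_cancel₀ hr (by linear_combination h1 - h0)
  have hc : c = 0 := mul_left_cancel₀ hr' (by linear_combination h2 - h0)
  exact ⟨by simpa [hb, hc] using h0, hb, hc⟩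

end AdmissibleSlopes

namespace IsEquivalenceTransformation

variable {Φ : OpenPartialHomeomorph ExtSpace ExtSpace} {z : ExtSpace}

theorem contDiffAt (hΦ : IsEquivalenceTransformation Φ) (hz : z ∈ Φ.source) : ContDiffAt ℝ ∞ Φ z :=
  hΦ.smooth.contDiffAt (Φ.open_source.mem_nhds hz)

theorem nonempty_admissibleSlopes (hΦ : IsEquivalenceTransformation Φ) (hz : z ∈ Φ.source) :
    (admissibleSlopes Φ z).Nonempty := by
  obtain ⟨D, K, q, hDK, rfl, hns⟩ := hΦ.nondegenerate z hz
  have hD := hDK.smooth_D.self_of_nhds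
  have hK := hDK.smooth_K.self_of_nhds
  have hφ := contDiffAt_inducedMap (hΦ.contDiffAt hz) hD hK
  rw [nonsingularAt_iff_det_jacobian_ne_zero (hφ.differentiableAt (by simp)),
    jacobian_inducedMap ((hΦ.contDiffAt hz).differentiableAt (by simp)) hD hK] at hns
  have hopen := isOpen_ne_fun (continuous_det_slopeJacobian Φ (liftPoint D K q))
    (continuous_const (y := (0 : ℝ)))
  have hdense : Dense {s : ℝ × ℝ | s.1 ≠ 0} :=
    (dense_compl_singleton (0 : ℝ)).preimage isOpenMap_fst
  obtain ⟨s, hs, hs'⟩ := hdense.inter_open_nonempty _ hopen ⟨_, hns⟩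
  exact ⟨s, hs', hs⟩

theorem eventually_contDiffAt_inducedMap (hΦ : IsEquivalenceTransformation Φ) {D K : ℝ → ℝ}
    {q : BaseSpace} (hDK : IsArbitraryElementAt D K (q 2)) (hq : liftPoint D K q ∈ Φ.source) :
    ∀ᶠ y in 𝓝 q, ContDiffAt ℝ ∞ (inducedMap Φ D K) y := by
  have hlift :=
    (contDiffAt_liftPoint hDK.smooth_D.self_of_nhds hDK.smooth_K.self_of_nhds).continuousAt
  have hu : ContinuousAt (fun y : BaseSpace => y 2) q := continuousAt_apply 2 q
  filter_upwards [hlift.eventually (Φ.open_source.mem_nhds hq), hu.eventually hDK.smooth_D,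
    hu.eventually hDK.smooth_K] with y hy hD hK
  exact contDiffAt_inducedMap (hΦ.contDiffAt hy) hD hK

theorem exists_transformsEquationAt (hΦ : IsEquivalenceTransformation Φ) {D K : ℝ → ℝ}
    {q : BaseSpace} (hDK : IsArbitraryElementAt D K (q 2)) (hq : liftPoint D K q ∈ Φ.source)
    (hdet : (slopeJacobian Φ (liftPoint D K q) (deriv D (q 2), deriv K (q 2))).det ≠ 0) :
    ∃ D' K' : ℝ → ℝ, DifferentiableAt ℝ K' (inducedMap Φ D K q 2) ∧
      (∀ᶠ y in 𝓝 q, TransformsEquationAt (inducedMap Φ D K) D K D' K' y) ∧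
      (∀ᶠ y in 𝓝 q, Φ (liftPoint D K y) 3 = D' (inducedMap Φ D K y 2)) ∧
      ∀ᶠ y in 𝓝 q, Φ (liftPoint D K y) 4 = K' (inducedMap Φ D K y 2) := by
  have hD := hDK.smooth_D.self_of_nhds
  have hK := hDK.smooth_K.self_of_nhds
  have hφ := contDiffAt_inducedMap (hΦ.contDiffAt hq) hD hK
  have hφd := hφ.differentiableAt (by simp)
  have hns : NonsingularAt (inducedMap Φ D K) q := by
    rwa [nonsingularAt_iff_det_jacobian_ne_zero hφd,
      jacobian_inducedMap ((hΦ.contDiffAt hq).differentiableAt (by simp)) hD hK]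
  obtain ⟨D', K', hDK', hcarries⟩ := hΦ.preserves D K q hDK hq hns
  have hu : ContinuousAt (fun y : BaseSpace => y 2) q := continuousAt_apply 2 q
  have hu' : ContinuousAt (fun y => inducedMap Φ D K y 2) q :=
    (continuousAt_apply 2 _).comp hφ.continuousAt
  have hDc : ContinuousAt (fun y : BaseSpace => D (y 2)) q :=
    ContinuousAt.comp (g := D) hD.continuousAt hu
  have hDc' : ContinuousAt (fun y => D' (inducedMap Φ D K y 2)) q :=
    ContinuousAt.comp (g := D') hDK'.smooth_D.self_of_nhds.continuousAt hu'
  refine ⟨D', K', hDK'.smooth_K.self_of_nhds.differentiableAt (by simp), ?_,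
    hcarries.mono fun y hy => hy.1, hcarries.mono fun y hy => hy.2.1⟩
  filter_upwards [hΦ.eventually_contDiffAt_inducedMap hDK hq,
    eventually_nonsingularAt (hφ.of_le two_le_infty) hns,
    hu.eventually hDK.smooth_D, hDc.eventually_ne hDK.ne_zero, hu'.eventually hDK'.smooth_D,
    hDc'.eventually_ne hDK'.ne_zero, hcarries] with y h₁ h₂ h₃ h₄ h₅ h₆ h₇
  exact ⟨h₁, h₂, h₃, h₄, h₅, h₆, h₇.2.2⟩

end IsEquivalenceTransformation

section QuadraticElements

theorem isArbitraryElementAt_quadraticPath {z₃ z₄ u₀ : ℝ} (hz : z₃ ≠ 0) {s : ℝ × ℝ} (hs : s.1 ≠ 0)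
    (k : ℝ × ℝ) :
    IsArbitraryElementAt (quadraticPath z₃ s.1 k.1 u₀) (quadraticPath z₄ s.2 k.2 u₀) u₀ where
  smooth_D := .of_forall fun _ => (contDiff_quadraticPath _ _ _ _).contDiffAt
  smooth_K := .of_forall fun _ => (contDiff_quadraticPath _ _ _ _).contDiffAt
  ne_zero := by rwa [quadraticPath_self]
  nonlinear h := hs (by simpa [deriv_quadraticPath] using h.self_of_nhds.1)

theorem pderiv_pderiv_comp_liftPoint_quadraticPath {z : ExtSpace} {f : ExtSpace → ℝ}
    (hf : ContDiffAt ℝ ∞ f z) {q : BaseSpace} (s k : ℝ × ℝ) {D K : ℝ → ℝ}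
    (hD : D = quadraticPath (z 3) s.1 k.1 (q 2)) (hK : K = quadraticPath (z 4) s.2 k.2 (q 2))
    (hlift : liftPoint D K q = z) :
    pderiv 2 (pderiv 2 fun y => f (liftPoint D K y)) q =
      fderiv ℝ (fderiv ℝ f) z ![0, 0, 1, s.1, s.2] ![0, 0, 1, s.1, s.2] +
        k.1 * pderiv 3 f z + k.2 * pderiv 4 f z := by
  have hcomp : ContDiffAt ℝ ∞ (fun y => f (liftPoint D K y)) q := by
    refine ContDiffAt.comp q (hlift ▸ hf) (contDiffAt_liftPoint ?_ ?_)
    · exact hD ▸ (contDiff_quadraticPath _ _ _ _).contDiffAt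
    · exact hK ▸ (contDiff_quadraticPath _ _ _ _).contDiffAt
  have hline (r : ℝ) : liftPoint D K (quadraticPath q (Pi.single 2 1) 0 0 r) =
      quadraticPath z ![0, 0, 1, s.1, s.2] ![0, 0, 0, k.1, k.2] 0 r := by
    ext i
    rw [hD, hK] at hlift ⊢
    rw [← hlift]
    fin_cases i <;> simp [liftPoint, quadraticPath]
  have hbase := deriv_deriv_comp_quadraticPath (hcomp.of_le two_le_infty) (Pi.single 2 1) 0 0
  simp only [hline] at hbase
  rw [deriv_deriv_comp_quadraticPath (hf.of_le two_le_infty), map_zero, add_zero,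
    ← pderiv_pderiv (hcomp.of_le two_le_infty)] at hbase
  rw [← hbase, fderiv_apply_eq_sum_pderiv _ _ ![0, 0, 0, k.1, k.2], Fin.sum_univ_five]
  simp
  ring

end QuadraticElements

namespace IsEquivalenceTransformation

variable {Φ : OpenPartialHomeomorph ExtSpace ExtSpace} {z : ExtSpace}

theorem exists_transformsEquationAt_quadraticPath (hΦ : IsEquivalenceTransformation Φ)
    (hz : z ∈ Φ.source) {s : ℝ × ℝ} (hs : s ∈ admissibleSlopes Φ z) (k : ℝ × ℝ) :
    ∃ (D K D' K' : ℝ → ℝ) (q : BaseSpace), D = quadraticPath (z 3) s.1 k.1 (q 2) ∧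
      K = quadraticPath (z 4) s.2 k.2 (q 2) ∧ liftPoint D K q = z ∧
      jacobian (inducedMap Φ D K) q = slopeJacobian Φ z s ∧
      DifferentiableAt ℝ K' (inducedMap Φ D K q 2) ∧
      (∀ᶠ y in 𝓝 q, TransformsEquationAt (inducedMap Φ D K) D K D' K' y) ∧
      (∀ᶠ y in 𝓝 q, Φ (liftPoint D K y) 3 = D' (inducedMap Φ D K y 2)) ∧
      ∀ᶠ y in 𝓝 q, Φ (liftPoint D K y) 4 = K' (inducedMap Φ D K y 2) := by
  set D := quadraticPath (z 3) s.1 k.1 (z 2) with hD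
  set K := quadraticPath (z 4) s.2 k.2 (z 2) with hK
  set q : BaseSpace := ![z 0, z 1, z 2]
  have hlift : liftPoint D K q = z := by
    ext i
    fin_cases i <;> simp [liftPoint, q, hD, hK, quadraticPath_self]
  have hDK : IsArbitraryElementAt D K (q 2) :=
    isArbitraryElementAt_quadraticPath (hΦ.source_subset hz) hs.1 k
  have hslopes : (deriv D (q 2), deriv K (q 2)) = s := by
    simp [hD, hK, q, deriv_quadraticPath]
  have hJ := jacobian_inducedMap
    (show DifferentiableAt ℝ Φ (liftPoint D K q) by
      rw [hlift]; exact (hΦ.contDiffAt hz).differentiableAt (by simp))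
    hDK.smooth_D.self_of_nhds hDK.smooth_K.self_of_nhds
  rw [hslopes, hlift] at hJ
  obtain ⟨D', K', h⟩ := hΦ.exists_transformsEquationAt hDK (by rwa [hlift])
    (by rw [hslopes, hlift]; exact hs.2)
  exact ⟨D, K, D', K', q, rfl, rfl, hlift, hJ, h⟩

theorem slopeJacobian_determining_equations (hΦ : IsEquivalenceTransformation Φ)
    (hz : z ∈ Φ.source) {s : ℝ × ℝ} (hs : s ∈ admissibleSlopes Φ z) :
    let M := slopeJacobian Φ z s
    (M 0 1 = 0 ∧ M 0 2 = 0 ∧ M 1 2 = 0) ∧ (M 0 0 ≠ 0 ∧ M 1 1 ≠ 0 ∧ M 2 2 ≠ 0) ∧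
      Φ z 3 * M 0 0 = z 3 * M 1 1 ^ 2 := by
  obtain ⟨D, K, D', K', q, -, -, hlift, hJ, -, h, h3, -⟩ :=
    hΦ.exists_transformsEquationAt_quadraticPath hz hs 0
  have hdiff := TransformsEquationAt.diffusion_eq h
  have hDq : D (q 2) = z 3 := congrFun hlift 3
  rw [← h3.self_of_nhds, hlift, hDq] at hdiff
  dsimp only
  rw [← hJ]
  exact ⟨⟨h.self_of_nhds.jacobian_time_eq_zero.1, h.self_of_nhds.jacobian_time_eq_zero.2,
    TransformsEquationAt.jacobian_space_value_eq_zero h⟩,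
    ⟨h.self_of_nhds.jacobian_time_time_ne_zero,
      TransformsEquationAt.jacobian_space_space_ne_zero h⟩, hdiff⟩

theorem jacobian_time_eq_zero (hΦ : IsEquivalenceTransformation Φ) (hz : z ∈ Φ.source) {j : Fin 5}
    (hj : j ≠ 0) : jacobian Φ z 0 j = 0 := by
  have hu := eq_zero_of_forall_mem_affine_eq_zero (isOpen_admissibleSlopes Φ z)
    (hΦ.nonempty_admissibleSlopes hz)
    fun _ hs => (hΦ.slopeJacobian_determining_equations hz hs).1.2.1
  obtain ⟨s, hs⟩ := hΦ.nonempty_admissibleSlopes hz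
  fin_cases j
  exacts [absurd rfl hj, (hΦ.slopeJacobian_determining_equations hz hs).1.1, hu.1, hu.2.1, hu.2.2]

theorem jacobian_space_eq_zero (hΦ : IsEquivalenceTransformation Φ) (hz : z ∈ Φ.source) :
    jacobian Φ z 1 2 = 0 ∧ jacobian Φ z 1 3 = 0 ∧ jacobian Φ z 1 4 = 0 :=
  eq_zero_of_forall_mem_affine_eq_zero (isOpen_admissibleSlopes Φ z)
    (hΦ.nonempty_admissibleSlopes hz)
    fun _ hs => (hΦ.slopeJacobian_determining_equations hz hs).1.2.2

theorem diffusion_eq (hΦ : IsEquivalenceTransformation Φ) (hz : z ∈ Φ.source) :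
    Φ z 3 * jacobian Φ z 0 0 = z 3 * jacobian Φ z 1 1 ^ 2 := by
  obtain ⟨s, hs⟩ := hΦ.nonempty_admissibleSlopes hz
  exact (hΦ.slopeJacobian_determining_equations hz hs).2.2

theorem fderiv_fderiv_value_eq_zero (hΦ : IsEquivalenceTransformation Φ) (hz : z ∈ Φ.source)
    {s : ℝ × ℝ} (hs : s ∈ admissibleSlopes Φ z) (k : ℝ × ℝ) :
    fderiv ℝ (fderiv ℝ fun y => Φ y 2) z ![0, 0, 1, s.1, s.2] ![0, 0, 1, s.1, s.2] +
      k.1 * jacobian Φ z 2 3 + k.2 * jacobian Φ z 2 4 = 0 := by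
  obtain ⟨D, K, D', K', q, hD, hK, hlift, -, -, h, -⟩ :=
    hΦ.exists_transformsEquationAt_quadraticPath hz hs k
  exact (pderiv_pderiv_comp_liftPoint_quadraticPath (contDiffAt_pi.1 (hΦ.contDiffAt hz) 2) s k
    hD hK hlift).symm.trans (TransformsEquationAt.pderiv_pderiv_value_eq_zero h)

theorem jacobian_value_eq_zero (hΦ : IsEquivalenceTransformation Φ) (hz : z ∈ Φ.source) :
    jacobian Φ z 2 3 = 0 ∧ jacobian Φ z 2 4 = 0 := by
  obtain ⟨s, hs⟩ := hΦ.nonempty_admissibleSlopes hz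
  exact (eq_zero_of_forall_mem_affine_eq_zero isOpen_univ univ_nonempty fun k _ =>
    hΦ.fderiv_fderiv_value_eq_zero hz hs k).2

theorem jacobian_ne_zero (hΦ : IsEquivalenceTransformation Φ) (hz : z ∈ Φ.source) :
    jacobian Φ z 0 0 ≠ 0 ∧ jacobian Φ z 1 1 ≠ 0 ∧ jacobian Φ z 2 2 ≠ 0 := by
  obtain ⟨s, hs⟩ := hΦ.nonempty_admissibleSlopes hz
  obtain ⟨hT, hX, hU⟩ := (hΦ.slopeJacobian_determining_equations hz hs).2.1
  obtain ⟨h3, h4⟩ := hΦ.jacobian_value_eq_zero hz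
  refine ⟨hT, hX, fun h2 => hU ?_⟩
  change jacobian Φ z 2 2 + s.1 * jacobian Φ z 2 3 + s.2 * jacobian Φ z 2 4 = 0
  rw [h2, h3, h4]
  ring

theorem pderiv_pderiv_eq_zero (hΦ : IsEquivalenceTransformation Φ) (hz : z ∈ Φ.source)
    {i j : Fin 5} (h : ∀ y ∈ Φ.source, jacobian Φ y i j = 0) (k : Fin 5) :
    pderiv k (pderiv j fun y => Φ y i) z = 0 ∧ pderiv j (pderiv k fun y => Φ y i) z = 0 := by
  have hk : pderiv k (pderiv j fun y => Φ y i) z = 0 :=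
    pderiv_pderiv_eq_zero_of_jacobian_eq_zero
      (eventually_of_mem (Φ.open_source.mem_nhds hz) h) k
  refine ⟨hk, ?_⟩
  rwa [pderiv_comm ((contDiffAt_pi.1 (hΦ.contDiffAt hz) i).of_le two_le_infty)]

theorem pderiv_pderiv_value_value_eq_zero (hΦ : IsEquivalenceTransformation Φ) (hz : z ∈ Φ.source) :
    pderiv 2 (pderiv 2 fun y => Φ y 2) z = 0 := by
  obtain ⟨s, hs⟩ := hΦ.nonempty_admissibleSlopes hz
  have h3 := hΦ.pderiv_pderiv_eq_zero hz fun y hy => (hΦ.jacobian_value_eq_zero hy).1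
  have h4 := hΦ.pderiv_pderiv_eq_zero hz fun y hy => (hΦ.jacobian_value_eq_zero hy).2
  have := hΦ.fderiv_fderiv_value_eq_zero hz hs 0
  rw [fderiv_fderiv_apply_eq_sum_pderiv
    ((contDiffAt_pi.1 (hΦ.contDiffAt hz) 2).of_le two_le_infty)] at this
  simpa [Fin.sum_univ_five, h3, h4] using this

theorem exists_jacobian_eq_mul (hΦ : IsEquivalenceTransformation Φ) (hz : z ∈ Φ.source)
    {s : ℝ × ℝ} (hs : s ∈ admissibleSlopes Φ z) :
    ∃ d k : ℝ, d * jacobian Φ z 2 2 * jacobian Φ z 0 0 = s.1 * jacobian Φ z 1 1 ^ 2 ∧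
      ∀ j : Fin 3, j ≠ 2 →
        jacobian Φ z 3 (j.castLE (by decide)) = d * jacobian Φ z 2 (j.castLE (by decide)) ∧
        jacobian Φ z 4 (j.castLE (by decide)) = k * jacobian Φ z 2 (j.castLE (by decide)) := by
  obtain ⟨D, K, D', K', q, hDs, hKs, hlift, hJ, hK', h, h3, h4⟩ :=
    hΦ.exists_transformsEquationAt_quadraticPath hz hs 0
  have hD : ContDiffAt ℝ ∞ D (q 2) := hDs ▸ (contDiff_quadraticPath _ _ _ _).contDiffAt
  have hK : ContDiffAt ℝ ∞ K (q 2) := hKs ▸ (contDiff_quadraticPath _ _ _ _).contDiffAt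
  have hD' := h.self_of_nhds.smooth_target.differentiableAt (by simp)
  have hΦz := hlift ▸ hΦ.contDiffAt hz
  have hDq : deriv D (q 2) = s.1 := by simp [hDs, deriv_quadraticPath]
  have hU : slopeJacobian Φ z s 2 2 = jacobian Φ z 2 2 := by
    obtain ⟨h3, h4⟩ := hΦ.jacobian_value_eq_zero hz
    change jacobian Φ z 2 2 + s.1 * jacobian Φ z 2 3 + s.2 * jacobian Φ z 2 4 = _
    rw [h3, h4]
    ring
  refine ⟨deriv D' (inducedMap Φ D K q 2), deriv K' (inducedMap Φ D K q 2), ?_, fun j hj => ?_⟩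
  · have := TransformsEquationAt.deriv_diffusion_eq h
    rwa [hJ, hDq, hU] at this
  · have hDj := jacobian_eq_deriv_mul_jacobian hΦz hD hK hD' h3 hj
    have hKj := jacobian_eq_deriv_mul_jacobian hΦz hD hK hK' h4 hj
    rw [hlift] at hDj hKj
    exact ⟨hDj, hKj⟩

theorem jacobian_base_eq_zero (hΦ : IsEquivalenceTransformation Φ) (hz : z ∈ Φ.source) {j : Fin 3}
    (hj : j ≠ 2) : jacobian Φ z 2 (j.castLE (by decide)) = 0 ∧
      jacobian Φ z 3 (j.castLE (by decide)) = 0 ∧ jacobian Φ z 4 (j.castLE (by decide)) = 0 := by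
  obtain ⟨-, hX, -⟩ := hΦ.jacobian_ne_zero hz
  have hU2 : -(jacobian Φ z 1 1 ^ 2 * jacobian Φ z 2 (j.castLE (by decide))) = 0 := by
    refine (eq_zero_of_forall_mem_affine_eq_zero (isOpen_admissibleSlopes Φ z)
      (hΦ.nonempty_admissibleSlopes hz)
      (a := jacobian Φ z 3 (j.castLE (by decide)) * jacobian Φ z 2 2 * jacobian Φ z 0 0) (c := 0)
      fun s hs => ?_).2.1
    obtain ⟨d, k, hd, hmul⟩ := hΦ.exists_jacobian_eq_mul hz hs
    linear_combination jacobian Φ z 2 (j.castLE (by decide)) * hd +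
      jacobian Φ z 2 2 * jacobian Φ z 0 0 * (hmul j hj).1
  have hUj := (mul_eq_zero.1 (neg_eq_zero.1 hU2)).resolve_left (pow_ne_zero 2 hX)
  obtain ⟨s, hs⟩ := hΦ.nonempty_admissibleSlopes hz
  obtain ⟨d, k, -, hmul⟩ := hΦ.exists_jacobian_eq_mul hz hs
  exact ⟨hUj, (hmul j hj).1.trans (mul_eq_zero_of_right d hUj),
    (hmul j hj).2.trans (mul_eq_zero_of_right k hUj)⟩

theorem convection_eq (hΦ : IsEquivalenceTransformation Φ) (hz : z ∈ Φ.source) :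
    Φ z 4 * jacobian Φ z 0 0 = z 4 * jacobian Φ z 1 1 - jacobian Φ z 1 0 := by
  obtain ⟨s, hs⟩ := hΦ.nonempty_admissibleSlopes hz
  obtain ⟨D, K, D', K', q, hDs, hKs, hlift, hJ, -, h, -, h4⟩ :=
    hΦ.exists_transformsEquationAt_quadraticPath hz hs 0
  have hD (u : ℝ) : ContDiffAt ℝ ∞ D u := hDs ▸ (contDiff_quadraticPath _ _ _ _).contDiffAt
  have hK (u : ℝ) : ContDiffAt ℝ ∞ K u := hKs ▸ (contDiff_quadraticPath _ _ _ _).contDiffAt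
  have hU : ∀ᶠ y in 𝓝 q, jacobian (inducedMap Φ D K) y 2 1 = 0 := by
    have hcont : ContinuousAt (liftPoint D K) q := (contDiffAt_liftPoint (hD _) (hK _)).continuousAt
    filter_upwards [hcont.eventually (Φ.open_source.mem_nhds (by rwa [hlift]))] with y hy
    rw [jacobian_inducedMap ((hΦ.contDiffAt hy).differentiableAt (by simp)) (hD _) (hK _)]
    exact (hΦ.jacobian_base_eq_zero (j := 1) hy (by decide)).1
  have hKq : K (q 2) = z 4 := congrFun hlift 4
  have := TransformsEquationAt.convection_eq h hU
  rwa [← h4.self_of_nhds, hlift, hKq, hJ] at this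

end IsEquivalenceTransformation

section SecondDerivatives

namespace IsEquivalenceTransformation

variable {Φ : OpenPartialHomeomorph ExtSpace ExtSpace} {z : ExtSpace}

theorem differentiableAt_component (hΦ : IsEquivalenceTransformation Φ) (hz : z ∈ Φ.source)
    (i : Fin 5) : DifferentiableAt ℝ (fun y => Φ y i) z :=
  (contDiffAt_pi.1 (hΦ.contDiffAt hz) i).differentiableAt (by simp)

theorem differentiableAt_jacobian (hΦ : IsEquivalenceTransformation Φ) (hz : z ∈ Φ.source)
    (i j : Fin 5) : DifferentiableAt ℝ (fun y => jacobian Φ y i j) z :=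
  differentiableAt_pderiv ((contDiffAt_pi.1 (hΦ.contDiffAt hz) i).of_le two_le_infty) j

theorem pderiv_diffusion_eq (hΦ : IsEquivalenceTransformation Φ) (hz : z ∈ Φ.source) (j : Fin 5) :
    Φ z 3 * pderiv j (pderiv 0 fun y => Φ y 0) z + jacobian Φ z 0 0 * jacobian Φ z 3 j =
      2 * z 3 * jacobian Φ z 1 1 * pderiv j (pderiv 1 fun y => Φ y 1) z +
        jacobian Φ z 1 1 ^ 2 * if 3 = j then 1 else 0 := by
  have hX := hΦ.differentiableAt_jacobian hz 1 1
  have h := pderiv_eq_of_eqOn Φ.open_source (fun y hy => hΦ.diffusion_eq hy) hz j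
  simp only [pow_two] at h
  rw [pderiv_mul (hΦ.differentiableAt_component hz 3) (hΦ.differentiableAt_jacobian hz 0 0),
    pderiv_mul (differentiableAt_apply 3 z) (hX.fun_mul hX), pderiv_mul hX hX, pderiv_coord] at h
  simp only [pderiv_jacobian] at h
  rw [jacobian_apply Φ z 3]
  linear_combination h

theorem pderiv_convection_eq (hΦ : IsEquivalenceTransformation Φ) (hz : z ∈ Φ.source) (j : Fin 5) :
    Φ z 4 * pderiv j (pderiv 0 fun y => Φ y 0) z + jacobian Φ z 0 0 * jacobian Φ z 4 j =
      z 4 * pderiv j (pderiv 1 fun y => Φ y 1) z + (jacobian Φ z 1 1 * if 4 = j then 1 else 0) -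
        pderiv j (pderiv 0 fun y => Φ y 1) z := by
  have hX := hΦ.differentiableAt_jacobian hz 1 1
  have h := pderiv_eq_of_eqOn Φ.open_source (fun y hy => hΦ.convection_eq hy) hz j
  rw [pderiv_mul (hΦ.differentiableAt_component hz 4) (hΦ.differentiableAt_jacobian hz 0 0),
    pderiv_sub ((differentiableAt_apply 4 z).fun_mul hX) (hΦ.differentiableAt_jacobian hz 1 0),
    pderiv_mul (differentiableAt_apply 4 z) hX, pderiv_coord] at h
  exact h

theorem jacobian_convection_mul_eq (hΦ : IsEquivalenceTransformation Φ) (hz : z ∈ Φ.source) :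
    jacobian Φ z 4 4 * jacobian Φ z 0 0 = jacobian Φ z 1 1 := by
  have hT := (hΦ.pderiv_pderiv_eq_zero hz (fun y hy => hΦ.jacobian_time_eq_zero hy
    (j := 4) (by decide)) 0).2
  have hX := hΦ.pderiv_pderiv_eq_zero hz fun y hy => (hΦ.jacobian_space_eq_zero hy).2.2
  have := hΦ.pderiv_convection_eq hz 4
  rw [if_pos rfl] at this
  linear_combination this - Φ z 4 * hT + z 4 * (hX 1).2 - (hX 0).2

theorem pderiv_pderiv_time_time_eq_zero (hΦ : IsEquivalenceTransformation Φ) (hz : z ∈ Φ.source) :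
    pderiv 0 (pderiv 0 fun y => Φ y 0) z = 0 ∧ pderiv 0 (pderiv 1 fun y => Φ y 1) z = 0 := by
  obtain ⟨-, hX, -⟩ := hΦ.jacobian_ne_zero hz
  have hD : jacobian Φ z 3 0 = 0 := (hΦ.jacobian_base_eq_zero (j := 0) hz (by decide)).2.1
  have hK := (hΦ.pderiv_pderiv_eq_zero (i := 4) (j := 0) hz
    (fun y hy => (hΦ.jacobian_base_eq_zero (j := 0) hy (by decide)).2.2) 4).2
  have h4 := pderiv_eq_of_eqOn Φ.open_source (fun y hy => hΦ.jacobian_convection_mul_eq hy) hz 0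
  rw [pderiv_mul (hΦ.differentiableAt_jacobian hz 4 4) (hΦ.differentiableAt_jacobian hz 0 0),
    pderiv_jacobian, pderiv_jacobian, pderiv_jacobian, hK, mul_zero, add_zero] at h4
  have h3 := hΦ.pderiv_diffusion_eq hz 0
  rw [if_neg (by decide)] at h3
  have hTT : z 3 * jacobian Φ z 1 1 ^ 2 * pderiv 0 (pderiv 0 fun y => Φ y 0) z = 0 := by
    linear_combination pderiv 0 (pderiv 0 fun y => Φ y 0) z * hΦ.diffusion_eq hz -
      jacobian Φ z 0 0 * h3 + jacobian Φ z 0 0 ^ 2 * hD +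
      2 * z 3 * jacobian Φ z 1 1 * jacobian Φ z 0 0 * h4 -
      2 * z 3 * jacobian Φ z 1 1 * pderiv 0 (pderiv 0 fun y => Φ y 0) z *
        hΦ.jacobian_convection_mul_eq hz
  have hTT' := (mul_eq_zero.1 hTT).resolve_left
    (mul_ne_zero (hΦ.source_subset hz) (pow_ne_zero 2 hX))
  exact ⟨hTT', h4.symm.trans (mul_eq_zero_of_right _ hTT')⟩

theorem pderiv_pderiv_time_eq_zero (hΦ : IsEquivalenceTransformation Φ) (hz : z ∈ Φ.source)
    (j k : Fin 5) : pderiv j (pderiv k fun y => Φ y 0) z = 0 := by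
  have h {i : Fin 5} (hi : i ≠ 0) :=
    hΦ.pderiv_pderiv_eq_zero hz (fun y hy => hΦ.jacobian_time_eq_zero hy hi)
  rcases eq_or_ne k 0 with rfl | hk
  · rcases eq_or_ne j 0 with rfl | hj
    · exact (hΦ.pderiv_pderiv_time_time_eq_zero hz).1
    · exact (h hj 0).2
  · exact (h hk j).1

theorem pderiv_pderiv_space_space_eq_zero (hΦ : IsEquivalenceTransformation Φ)
    (hz : z ∈ Φ.source) : pderiv 1 (pderiv 1 fun y => Φ y 1) z = 0 := by
  have hD : jacobian Φ z 3 1 = 0 := (hΦ.jacobian_base_eq_zero (j := 1) hz (by decide)).2.1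
  have h := hΦ.pderiv_diffusion_eq hz 1
  rw [hΦ.pderiv_pderiv_time_eq_zero hz, hD, if_neg (by decide)] at h
  have hX : 2 * z 3 * jacobian Φ z 1 1 * pderiv 1 (pderiv 1 fun y => Φ y 1) z = 0 := by
    linear_combination -h
  exact (mul_eq_zero.1 hX).resolve_left
    (mul_ne_zero (mul_ne_zero two_ne_zero (hΦ.source_subset hz)) (hΦ.jacobian_ne_zero hz).2.1)

theorem pderiv_time_pderiv_time_space_eq_zero (hΦ : IsEquivalenceTransformation Φ)
    (hz : z ∈ Φ.source) : pderiv 0 (pderiv 0 fun y => Φ y 1) z = 0 := by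
  obtain ⟨hTT, hXX⟩ := hΦ.pderiv_pderiv_time_time_eq_zero hz
  have hK : jacobian Φ z 4 0 = 0 := (hΦ.jacobian_base_eq_zero (j := 0) hz (by decide)).2.2
  have h := hΦ.pderiv_convection_eq hz 0
  rw [hTT, hXX, hK, if_neg (by decide)] at h
  linear_combination h

theorem pderiv_pderiv_space_eq_zero (hΦ : IsEquivalenceTransformation Φ) (hz : z ∈ Φ.source)
    (j k : Fin 5) : pderiv j (pderiv k fun y => Φ y 1) z = 0 := by
  have h2 := hΦ.pderiv_pderiv_eq_zero hz fun y hy => (hΦ.jacobian_space_eq_zero hy).1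
  have h3 := hΦ.pderiv_pderiv_eq_zero hz fun y hy => (hΦ.jacobian_space_eq_zero hy).2.1
  have h4 := hΦ.pderiv_pderiv_eq_zero hz fun y hy => (hΦ.jacobian_space_eq_zero hy).2.2
  have h00 := hΦ.pderiv_time_pderiv_time_space_eq_zero hz
  have h01 := (hΦ.pderiv_pderiv_time_time_eq_zero hz).2
  have h10 := h01
  rw [pderiv_comm ((contDiffAt_pi.1 (hΦ.contDiffAt hz) 1).of_le two_le_infty)] at h10
  have h11 := hΦ.pderiv_pderiv_space_space_eq_zero hz
  fin_cases k
  · fin_cases j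
    exacts [h00, h10, (h2 0).2, (h3 0).2, (h4 0).2]
  · fin_cases j
    exacts [h01, h11, (h2 1).2, (h3 1).2, (h4 1).2]
  exacts [(h2 j).1, (h3 j).1, (h4 j).1]

theorem pderiv_pderiv_value_eq_zero (hΦ : IsEquivalenceTransformation Φ) (hz : z ∈ Φ.source)
    (j k : Fin 5) : pderiv j (pderiv k fun y => Φ y 2) z = 0 := by
  have h {i : Fin 3} (hi : i ≠ 2) :=
    hΦ.pderiv_pderiv_eq_zero hz fun y hy => (hΦ.jacobian_base_eq_zero hy hi).1
  have h0 := h (i := 0) (by decide)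
  have h1 := h (i := 1) (by decide)
  have h3 := hΦ.pderiv_pderiv_eq_zero hz fun y hy => (hΦ.jacobian_value_eq_zero hy).1
  have h4 := hΦ.pderiv_pderiv_eq_zero hz fun y hy => (hΦ.jacobian_value_eq_zero hy).2
  fin_cases k
  · exact (h0 j).1
  · exact (h1 j).1
  · fin_cases j
    exacts [(h0 2).2, (h1 2).2, hΦ.pderiv_pderiv_value_value_eq_zero hz, (h3 2).2, (h4 2).2]
  exacts [(h3 j).1, (h4 j).1]

end IsEquivalenceTransformation

end SecondDerivatives

section AffineForm

/-- The transformation of the extended space with the group parameters `ε`, where `ε i` is the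
parameter `ε_{i+1}` of the paper. -/
noncomputable def equivalenceMap (ε : Fin 7 → ℝ) (z : ExtSpace) : ExtSpace :=
  ![z 0 * ε 3 ^ 2 * ε 4 + ε 0, z 1 * ε 3 + ε 6 * z 0 + ε 1, z 2 * ε 5 + ε 2, z 3 * (ε 4)⁻¹,
    z 4 * (ε 3)⁻¹ * (ε 4)⁻¹ - ε 6 * (ε 3 ^ 2)⁻¹ * (ε 4)⁻¹]

namespace IsEquivalenceTransformation

variable {Φ : OpenPartialHomeomorph ExtSpace ExtSpace} {S : Set ExtSpace} {y z : ExtSpace}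

theorem pderiv_pderiv_base_eq_zero (hΦ : IsEquivalenceTransformation Φ) (hz : z ∈ Φ.source)
    (i : Fin 3) (j k : Fin 5) :
    pderiv j (pderiv k fun y => Φ y (i.castLE (by decide))) z = 0 := by
  fin_cases i
  exacts [hΦ.pderiv_pderiv_time_eq_zero hz j k, hΦ.pderiv_pderiv_space_eq_zero hz j k,
    hΦ.pderiv_pderiv_value_eq_zero hz j k]

theorem jacobian_base_eq (hΦ : IsEquivalenceTransformation Φ) (hS : IsOpen S)
    (hS' : IsPreconnected S) (hsub : S ⊆ Φ.source) (hz : z ∈ S) (hy : y ∈ S) (i : Fin 3)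
    (j : Fin 5) :
    jacobian Φ y (i.castLE (by decide)) j = jacobian Φ z (i.castLE (by decide)) j :=
  eq_of_pderiv_eq_zero (f := fun y => jacobian Φ y (i.castLE (by decide)) j) hS hS'
    (fun _ hx => hΦ.differentiableAt_jacobian (hsub hx) _ _)
    (fun _ hx k => hΦ.pderiv_pderiv_base_eq_zero (hsub hx) i k j) hz hy

theorem apply_base_eq (hΦ : IsEquivalenceTransformation Φ) (hS : IsOpen S)
    (hS' : IsPreconnected S) (hsub : S ⊆ Φ.source) (hz : z ∈ S) (hy : y ∈ S) :
    Φ y 0 = Φ z 0 + (y 0 - z 0) * jacobian Φ z 0 0 ∧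
      Φ y 1 = Φ z 1 + (y 0 - z 0) * jacobian Φ z 1 0 + (y 1 - z 1) * jacobian Φ z 1 1 ∧
      Φ y 2 = Φ z 2 + (y 2 - z 2) * jacobian Φ z 2 2 := by
  have h (i : Fin 3) : Φ y (i.castLE (by decide)) = Φ z (i.castLE (by decide)) +
      ∑ j, (y j - z j) * jacobian Φ z (i.castLE (by decide)) j :=
    eq_add_sum_pderiv_of_pderiv_pderiv_eq_zero hS hS'
      (fun x hx => (contDiffAt_pi.1 (hΦ.contDiffAt (hsub hx)) _).of_le two_le_infty)
      (fun x hx j k => hΦ.pderiv_pderiv_base_eq_zero (hsub hx) i j k) hz hy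
  have hT {j : Fin 5} (hj : j ≠ 0) := hΦ.jacobian_time_eq_zero (hsub hz) hj
  obtain ⟨hX2, hX3, hX4⟩ := hΦ.jacobian_space_eq_zero (hsub hz)
  have hU {j : Fin 3} (hj : j ≠ 2) := (hΦ.jacobian_base_eq_zero (hsub hz) hj).1
  obtain ⟨hU3, hU4⟩ := hΦ.jacobian_value_eq_zero (hsub hz)
  have hU0 : jacobian Φ z 2 0 = 0 := hU (j := 0) (by decide)
  have hU1 : jacobian Φ z 2 1 = 0 := hU (j := 1) (by decide)
  refine ⟨(h 0).trans ?_, (h 1).trans ?_, (h 2).trans ?_⟩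
  · simp [Fin.sum_univ_five, hT]
  · simp [Fin.sum_univ_five, hX2, hX3, hX4, add_assoc]
  · simp [Fin.sum_univ_five, hU0, hU1, hU3, hU4]

theorem exists_eqOn_equivalenceMap (hΦ : IsEquivalenceTransformation Φ) (hS : IsOpen S)
    (hS' : IsPreconnected S) (hsub : S ⊆ Φ.source) :
    ∃ ε : Fin 7 → ℝ, ε 3 * ε 4 * ε 5 ≠ 0 ∧ EqOn Φ (equivalenceMap ε) S := by
  rcases S.eq_empty_or_nonempty with rfl | ⟨z, hz⟩
  · exact ⟨fun _ => 1, by simp, eqOn_empty _ _⟩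
  obtain ⟨hT, hX, hU⟩ := hΦ.jacobian_ne_zero (hsub hz)
  set T := jacobian Φ z 0 0
  set X := jacobian Φ z 1 1
  set U := jacobian Φ z 2 2
  set W := jacobian Φ z 1 0
  refine ⟨![Φ z 0 - z 0 * T, Φ z 1 - z 0 * W - z 1 * X, Φ z 2 - z 2 * U, X, T / X ^ 2, U, W],
    mul_ne_zero (mul_ne_zero hX (div_ne_zero hT (pow_ne_zero 2 hX))) hU, fun y hy => ?_⟩
  obtain ⟨h0, h1, h2⟩ := hΦ.apply_base_eq hS hS' hsub hz hy
  have hJT : jacobian Φ y 0 0 = T := hΦ.jacobian_base_eq hS hS' hsub hz hy 0 0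
  have hJX : jacobian Φ y 1 1 = X := hΦ.jacobian_base_eq hS hS' hsub hz hy 1 1
  have hJW : jacobian Φ y 1 0 = W := hΦ.jacobian_base_eq hS hS' hsub hz hy 1 0
  have h3 : Φ y 3 * T = y 3 * X ^ 2 := hJT ▸ hJX ▸ hΦ.diffusion_eq (hsub hy)
  have h4 : Φ y 4 * T = y 4 * X - W := hJT ▸ hJX ▸ hJW ▸ hΦ.convection_eq (hsub hy)
  ext i
  fin_cases i
  · change Φ y 0 = y 0 * X ^ 2 * (T / X ^ 2) + (Φ z 0 - z 0 * T)
    rw [h0]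
    field_simp
    ring
  · change Φ y 1 = y 1 * X + W * y 0 + (Φ z 1 - z 0 * W - z 1 * X)
    linear_combination h1
  · change Φ y 2 = y 2 * U + (Φ z 2 - z 2 * U)
    linear_combination h2
  · change Φ y 3 = y 3 * (T / X ^ 2)⁻¹
    field_simp
    linear_combination h3
  · change Φ y 4 = y 4 * X⁻¹ * (T / X ^ 2)⁻¹ - W * (X ^ 2)⁻¹ * (T / X ^ 2)⁻¹
    field_simp
    linear_combination h4

end IsEquivalenceTransformation

end AffineForm

section EquivalenceMap

variable {ε : Fin 7 → ℝ}

theorem contDiff_equivalenceMap (ε : Fin 7 → ℝ) {n : ℕ∞ω} : ContDiff ℝ n (equivalenceMap ε) := by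
  refine contDiff_pi.2 fun i => ?_
  fin_cases i <;> simp only [equivalenceMap, Fin.reduceFinMk, Matrix.cons_val] <;> fun_prop

/-- The group parameters of the inverse of `equivalenceMap ε`. -/
noncomputable def inverseParameters (ε : Fin 7 → ℝ) : Fin 7 → ℝ :=
  ![-ε 0 * (ε 3 ^ 2 * ε 4)⁻¹, ε 6 * ε 0 * (ε 3 ^ 3 * ε 4)⁻¹ - ε 1 * (ε 3)⁻¹, -ε 2 * (ε 5)⁻¹,
    (ε 3)⁻¹, (ε 4)⁻¹, (ε 5)⁻¹, -ε 6 * (ε 3 ^ 3 * ε 4)⁻¹]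

theorem equivalenceMap_inverseParameters_left (h₃ : ε 3 ≠ 0) (h₄ : ε 4 ≠ 0) (h₅ : ε 5 ≠ 0)
    (z : ExtSpace) : equivalenceMap (inverseParameters ε) (equivalenceMap ε z) = z := by
  ext i
  fin_cases i <;> simp [equivalenceMap, inverseParameters] <;> field_simp <;> ring

theorem equivalenceMap_inverseParameters_right (h₃ : ε 3 ≠ 0) (h₄ : ε 4 ≠ 0) (h₅ : ε 5 ≠ 0)
    (z : ExtSpace) : equivalenceMap ε (equivalenceMap (inverseParameters ε) z) = z := by
  ext i
  fin_cases i <;> simp [equivalenceMap, inverseParameters] <;> field_simp <;> ring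

/-- The transformation with nonzero scaling parameters as a homeomorphism of the extended space. -/
noncomputable def equivalenceHomeomorph (ε : Fin 7 → ℝ) (h₃ : ε 3 ≠ 0) (h₄ : ε 4 ≠ 0)
    (h₅ : ε 5 ≠ 0) : ExtSpace ≃ₜ ExtSpace where
  toFun := equivalenceMap ε
  invFun := equivalenceMap (inverseParameters ε)
  left_inv := equivalenceMap_inverseParameters_left h₃ h₄ h₅
  right_inv := equivalenceMap_inverseParameters_right h₃ h₄ h₅
  continuous_toFun := (contDiff_equivalenceMap ε (n := 0)).continuous
  continuous_invFun := (contDiff_equivalenceMap _ (n := 0)).continuous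

/-- The action of `equivalenceMap ε` on the variables `(t, x, u)`. -/
def equivalenceBaseMap (ε : Fin 7 → ℝ) (q : BaseSpace) : BaseSpace :=
  ![q 0 * ε 3 ^ 2 * ε 4 + ε 0, q 1 * ε 3 + ε 6 * q 0 + ε 1, q 2 * ε 5 + ε 2]

theorem equivalenceBaseMap_eq_mulVec_add (ε : Fin 7 → ℝ) (q : BaseSpace) :
    equivalenceBaseMap ε q =
      (!![ε 3 ^ 2 * ε 4, 0, 0; ε 6, ε 3, 0; 0, 0, ε 5] : Matrix (Fin 3) (Fin 3) ℝ).mulVec q +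
        ![ε 0, ε 1, ε 2] := by
  ext i
  fin_cases i <;> simp [equivalenceBaseMap, dotProduct, Fin.sum_univ_three] <;> ring

theorem nonsingularAt_equivalenceBaseMap (h₃ : ε 3 ≠ 0) (h₄ : ε 4 ≠ 0) (h₅ : ε 5 ≠ 0)
    (q : BaseSpace) : NonsingularAt (equivalenceBaseMap ε) q := by
  let M : Matrix (Fin 3) (Fin 3) ℝ := !![ε 3 ^ 2 * ε 4, 0, 0; ε 6, ε 3, 0; 0, 0, ε 5]
  have hdet : IsUnit M.det := by
    rw [isUnit_iff_ne_zero, Matrix.det_fin_three]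
    simp [M, h₃, h₄, h₅]
  have hderiv : HasFDerivAt (equivalenceBaseMap ε) M.mulVecLin.toContinuousLinearMap q := by
    rw [funext (equivalenceBaseMap_eq_mulVec_add ε)]
    exact M.mulVecLin.toContinuousLinearMap.hasFDerivAt.add_const _
  rw [NonsingularAt, hderiv.fderiv]
  have hM := (Matrix.isUnit_iff_isUnit_det M).2 hdet
  exact ⟨Matrix.mulVec_injective_iff_isUnit.2 hM, Matrix.mulVec_surjective_iff_isUnit.2 hM⟩

theorem inducedMap_eq_equivalenceBaseMap {Φ : ExtSpace → ExtSpace} {D K : ℝ → ℝ} {q : BaseSpace}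
    (h : Φ (liftPoint D K q) = equivalenceMap ε (liftPoint D K q)) :
    inducedMap Φ D K q = equivalenceBaseMap ε q := by
  rw [inducedMap, h]
  rfl

/-- The transformed arbitrary element `D`. -/
noncomputable def transformedDiffusion (ε : Fin 7 → ℝ) (D : ℝ → ℝ) (v : ℝ) : ℝ :=
  D ((v - ε 2) / ε 5) * (ε 4)⁻¹

/-- The transformed arbitrary element `K`. -/
noncomputable def transformedConvection (ε : Fin 7 → ℝ) (K : ℝ → ℝ) (v : ℝ) : ℝ :=
  K ((v - ε 2) / ε 5) * (ε 3)⁻¹ * (ε 4)⁻¹ - ε 6 * (ε 3 ^ 2)⁻¹ * (ε 4)⁻¹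

section TransformedElements

variable {D K f : ℝ → ℝ} {u m n : ℝ}

theorem hasDerivAt_comp_sub_div (hm : m ≠ 0) (hf : DifferentiableAt ℝ f u) :
    HasDerivAt (fun v => f ((v - n) / m)) (deriv f u / m) (u * m + n) := by
  have hinner : HasDerivAt (fun v : ℝ => (v - n) / m) (1 / m) (u * m + n) :=
    ((hasDerivAt_id _).sub_const n).div_const m
  have hu : (u * m + n - n) / m = u := by field_simp; ring
  have houter : HasDerivAt f (deriv f u) ((u * m + n - n) / m) := hu.symm ▸ hf.hasDerivAt
  rw [← mul_one_div]
  exact HasDerivAt.comp (h := fun v => (v - n) / m) _ houter hinner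

theorem transformedDiffusion_apply (h₅ : ε 5 ≠ 0) (D : ℝ → ℝ) (u : ℝ) :
    transformedDiffusion ε D (u * ε 5 + ε 2) = D u * (ε 4)⁻¹ := by
  simp [transformedDiffusion, h₅]

theorem transformedConvection_apply (h₅ : ε 5 ≠ 0) (K : ℝ → ℝ) (u : ℝ) :
    transformedConvection ε K (u * ε 5 + ε 2) =
      K u * (ε 3)⁻¹ * (ε 4)⁻¹ - ε 6 * (ε 3 ^ 2)⁻¹ * (ε 4)⁻¹ := by
  simp [transformedConvection, h₅]

theorem hasDerivAt_transformedDiffusion (h₅ : ε 5 ≠ 0) (hD : DifferentiableAt ℝ D u) :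
    HasDerivAt (transformedDiffusion ε D) (deriv D u / ε 5 * (ε 4)⁻¹) (u * ε 5 + ε 2) :=
  (hasDerivAt_comp_sub_div h₅ hD).mul_const _

theorem hasDerivAt_transformedConvection (h₅ : ε 5 ≠ 0) (hK : DifferentiableAt ℝ K u) :
    HasDerivAt (transformedConvection ε K) (deriv K u / ε 5 * (ε 3)⁻¹ * (ε 4)⁻¹)
      (u * ε 5 + ε 2) :=
  (((hasDerivAt_comp_sub_div h₅ hK).mul_const _).mul_const _).sub_const _

theorem IsArbitraryElementAt.transformed (h : IsArbitraryElementAt D K u) (h₃ : ε 3 ≠ 0)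
    (h₄ : ε 4 ≠ 0) (h₅ : ε 5 ≠ 0) :
    IsArbitraryElementAt (transformedDiffusion ε D) (transformedConvection ε K)
      (u * ε 5 + ε 2) := by
  have hinv : Tendsto (fun v => (v - ε 2) / ε 5) (𝓝 (u * ε 5 + ε 2)) (𝓝 u) := by
    have : ContinuousAt (fun v => (v - ε 2) / ε 5) (u * ε 5 + ε 2) := by fun_prop
    simpa [ContinuousAt, h₅] using this
  have hsmooth {f : ℝ → ℝ} {v : ℝ} (hf : ContDiffAt ℝ ∞ f ((v - ε 2) / ε 5)) :
      ContDiffAt ℝ ∞ (fun v => f ((v - ε 2) / ε 5)) v :=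
    hf.comp v (by fun_prop)
  refine ⟨?_, ?_, ?_, fun hzero => h.nonlinear ?_⟩
  · exact (hinv.eventually h.smooth_D).mono fun v hv => (hsmooth hv).mul contDiffAt_const
  · exact (hinv.eventually h.smooth_K).mono fun v hv =>
      (((hsmooth hv).mul contDiffAt_const).mul contDiffAt_const).sub contDiffAt_const
  · rw [transformedDiffusion_apply h₅]
    exact mul_ne_zero h.ne_zero (inv_ne_zero h₄)
  · have haffine : ContinuousAt (fun y => y * ε 5 + ε 2) u := by fun_prop
    filter_upwards [h.smooth_D, h.smooth_K, haffine.eventually hzero] with y hD hK hy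
    rw [(hasDerivAt_transformedDiffusion h₅ (hD.differentiableAt (by simp))).deriv,
      (hasDerivAt_transformedConvection h₅ (hK.differentiableAt (by simp))).deriv] at hy
    simpa [h₃, h₄, h₅] using hy

end TransformedElements

section CarriedEquation

variable {D K : ℝ → ℝ} {q : BaseSpace} {w w' : ℝ → ℝ → ℝ}

theorem deriv_eq_of_graph_equivalenceBaseMap
    (hw' : ContDiffAt ℝ 2 (fun s : ℝ × ℝ => w' s.1 s.2)
      (equivalenceBaseMap ε q 0, equivalenceBaseMap ε q 1))
    (hgraph : ∀ᶠ s : ℝ × ℝ in 𝓝 (q 0, q 1),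
      w' (s.1 * ε 3 ^ 2 * ε 4 + ε 0) (s.2 * ε 3 + ε 6 * s.1 + ε 1) = w s.1 s.2 * ε 5 + ε 2) :
    deriv (fun t => w' t (equivalenceBaseMap ε q 1)) (equivalenceBaseMap ε q 0) *
          (ε 3 ^ 2 * ε 4) +
        deriv (w' (equivalenceBaseMap ε q 0)) (equivalenceBaseMap ε q 1) * ε 6 =
          deriv (fun t => w t (q 1)) (q 0) * ε 5 ∧
      deriv (w' (equivalenceBaseMap ε q 0)) (equivalenceBaseMap ε q 1) * ε 3 =
        deriv (w (q 0)) (q 1) * ε 5 ∧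
      deriv (deriv (w' (equivalenceBaseMap ε q 0))) (equivalenceBaseMap ε q 1) * ε 3 ^ 2 =
        deriv (deriv (w (q 0))) (q 1) * ε 5 := by
  have htime : ∀ᶠ s in 𝓝 (q 0), w' (s * ε 3 ^ 2 * ε 4 + ε 0) (q 1 * ε 3 + ε 6 * s + ε 1) =
      w s (q 1) * ε 5 + ε 2 :=
    (by fun_prop : ContinuousAt (fun s => (s, q 1)) (q 0)).eventually hgraph
  have hspace : ∀ᶠ s in 𝓝 (q 1), w' (q 0 * ε 3 ^ 2 * ε 4 + ε 0) (s * ε 3 + ε 6 * q 0 + ε 1) =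
      w (q 0) s * ε 5 + ε 2 :=
    (by fun_prop : ContinuousAt (fun s => (q 0, s)) (q 1)).eventually hgraph
  have hwd := hw'.differentiableAt (by simp)
  refine ⟨?_, ?_, ?_⟩
  · have := deriv_eq_of_curve_in_graph (s := q 0) hwd (by fun_prop) (by fun_prop) htime
    simpa [equivalenceBaseMap, mul_assoc] using this
  · have := deriv_eq_of_curve_in_graph (s := q 1) hwd (by fun_prop) (by fun_prop) hspace
    simpa [equivalenceBaseMap] using this
  · have := deriv_deriv_eq_of_curve_in_graph (s := q 1) hw' (by fun_prop) (by fun_prop) (by simp)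
      hspace
    simpa [equivalenceBaseMap] using this

theorem carriesEquationAt_equivalenceBaseMap (h₃ : ε 3 ≠ 0) (h₄ : ε 4 ≠ 0) (h₅ : ε 5 ≠ 0)
    (hD : DifferentiableAt ℝ D (q 2)) :
    CarriesEquationAt (equivalenceBaseMap ε) D K (transformedDiffusion ε D)
      (transformedConvection ε K) q := by
  intro w w' hw hwq hw' hgraph
  have hself : w' (equivalenceBaseMap ε q 0) (equivalenceBaseMap ε q 1) = q 2 * ε 5 + ε 2 :=
    hwq ▸ hgraph.self_of_nhds
  have hD' := hasDerivAt_transformedDiffusion (ε := ε) h₅ hD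
  obtain ⟨htime, hspace, hspace₂⟩ :=
    deriv_eq_of_graph_equivalenceBaseMap (hw'.of_le two_le_infty) hgraph
  rw [satisfiesAt_iff ((hw.of_le two_le_infty).comp (q 1) (by fun_prop)) (by rwa [hwq]),
    satisfiesAt_iff ((hw'.of_le two_le_infty).comp (f := fun y => (_, y)) _ (by fun_prop))
      (hself ▸ hD'.differentiableAt), hself, hwq, hD'.deriv, transformedDiffusion_apply h₅,
    transformedConvection_apply h₅]
  rw [eq_comm, ← eq_div_iff h₅] at htime hspace hspace₂
  rw [htime, hspace, hspace₂]
  constructor <;> intro h <;> field_simp at h ⊢ <;> linear_combination h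

theorem CarriesEquationAt.congr {φ ψ : BaseSpace → BaseSpace} {D' K' : ℝ → ℝ}
    (h : CarriesEquationAt ψ D K D' K' q) (hφ : φ =ᶠ[𝓝 q] ψ) :
    CarriesEquationAt φ D K D' K' q := by
  intro w w' hw hwq hw' hgraph
  have hcont : Tendsto (graphPoint w) (𝓝 (q 0, q 1)) (𝓝 q) := by
    simpa only [ContinuousAt, graphPoint_eq hwq] using (contDiffAt_graphPoint hw).continuousAt
  rw [hφ.self_of_nhds] at hw' ⊢
  refine h w w' hw hwq hw' ?_
  filter_upwards [hgraph, hcont.eventually hφ] with s hs hφs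
  rw [graphPoint] at hφs
  rwa [hφs] at hs

end CarriedEquation

section Converse

variable {Φ : OpenPartialHomeomorph ExtSpace ExtSpace} {D K : ℝ → ℝ} {q : BaseSpace}

theorem contDiffOn_symm_of_eqOn_equivalenceMap (h₃ : ε 3 ≠ 0) (h₄ : ε 4 ≠ 0) (h₅ : ε 5 ≠ 0)
    (hΦ : EqOn Φ (equivalenceMap ε) Φ.source) : ContDiffOn ℝ ∞ Φ.symm Φ.target := by
  refine (contDiff_equivalenceMap (inverseParameters ε)).contDiffOn.congr fun y hy => ?_
  rw [← equivalenceMap_inverseParameters_left h₃ h₄ h₅ (Φ.symm y), ← hΦ (Φ.map_target hy),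
    Φ.right_inv hy]

theorem eventually_liftPoint_mem_source (hD : ContDiffAt ℝ ∞ D (q 2))
    (hK : ContDiffAt ℝ ∞ K (q 2)) (hq : liftPoint D K q ∈ Φ.source) :
    ∀ᶠ y in 𝓝 q, liftPoint D K y ∈ Φ.source :=
  (contDiffAt_liftPoint hD hK).continuousAt.eventually_mem (Φ.open_source.mem_nhds hq)

theorem inducedMap_eventuallyEq_equivalenceBaseMap (hΦ : EqOn Φ (equivalenceMap ε) Φ.source)
    (hD : ContDiffAt ℝ ∞ D (q 2)) (hK : ContDiffAt ℝ ∞ K (q 2))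
    (hq : liftPoint D K q ∈ Φ.source) : inducedMap Φ D K =ᶠ[𝓝 q] equivalenceBaseMap ε :=
  (eventually_liftPoint_mem_source hD hK hq).mono fun _ hy =>
    inducedMap_eq_equivalenceBaseMap (hΦ hy)

theorem exists_nonsingularAt_inducedMap (h₃ : ε 3 ≠ 0) (h₄ : ε 4 ≠ 0) (h₅ : ε 5 ≠ 0)
    (hΦ : EqOn Φ (equivalenceMap ε) Φ.source) {z : ExtSpace} (hz : z ∈ Φ.source) (hz₃ : z 3 ≠ 0) :
    ∃ (D K : ℝ → ℝ) (q : BaseSpace),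
      IsArbitraryElementAt D K (q 2) ∧ liftPoint D K q = z ∧
        NonsingularAt (inducedMap Φ D K) q := by
  refine ⟨quadraticPath (z 3) 1 0 (z 2), quadraticPath (z 4) 0 0 (z 2), ![z 0, z 1, z 2],
    isArbitraryElementAt_quadraticPath hz₃ (s := (1, 0)) one_ne_zero 0, ?_⟩
  have hlift : liftPoint (quadraticPath (z 3) 1 0 (z 2)) (quadraticPath (z 4) 0 0 (z 2))
      ![z 0, z 1, z 2] = z := by
    ext i
    fin_cases i <;> simp [liftPoint, quadraticPath_self]
  refine ⟨hlift, ?_⟩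
  rw [NonsingularAt, (inducedMap_eventuallyEq_equivalenceBaseMap hΦ
    (contDiff_quadraticPath _ _ _ _).contDiffAt (contDiff_quadraticPath _ _ _ _).contDiffAt
    (by rwa [hlift])).fderiv_eq]
  exact nonsingularAt_equivalenceBaseMap h₃ h₄ h₅ _

theorem isEquivalenceTransformation_of_eqOn (hsub : Φ.source ⊆ diffusiveRegion)
    (hε : ε 3 * ε 4 * ε 5 ≠ 0) (hΦ : EqOn Φ (equivalenceMap ε) Φ.source) :
    IsEquivalenceTransformation Φ := by
  obtain ⟨⟨h₃, h₄⟩, h₅⟩ : (ε 3 ≠ 0 ∧ ε 4 ≠ 0) ∧ ε 5 ≠ 0 := by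
    simpa only [mul_ne_zero_iff] using hε
  refine ⟨hsub, (contDiff_equivalenceMap ε).contDiffOn.congr hΦ,
    contDiffOn_symm_of_eqOn_equivalenceMap h₃ h₄ h₅ hΦ,
    fun z hz => exists_nonsingularAt_inducedMap h₃ h₄ h₅ hΦ hz (hsub hz),
    fun D K q₀ hDK hmem _ => ⟨transformedDiffusion ε D, transformedConvection ε K, ?_, ?_⟩⟩
  · rw [inducedMap_eq_equivalenceBaseMap (hΦ hmem)]
    exact hDK.transformed h₃ h₄ h₅
  · have hvalue : ContinuousAt (fun q : BaseSpace => q 2) q₀ := (continuous_apply 2).continuousAt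
    filter_upwards [hvalue.eventually hDK.smooth_D, hvalue.eventually hDK.smooth_K,
      eventually_liftPoint_mem_source hDK.smooth_D.self_of_nhds hDK.smooth_K.self_of_nhds hmem]
      with q hD hK hq
    rw [inducedMap_eq_equivalenceBaseMap (hΦ hq), hΦ hq]
    refine ⟨(transformedDiffusion_apply h₅ D (q 2)).symm,
      (transformedConvection_apply h₅ K (q 2)).symm, ?_⟩
    exact (carriesEquationAt_equivalenceBaseMap h₃ h₄ h₅
      (hD.differentiableAt (by simp))).congr
        (inducedMap_eventuallyEq_equivalenceBaseMap hΦ hD hK hq)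

end Converse

end EquivalenceMap

section EquivalenceField

/-- The linear combination with the coefficients `c` of the seven vector fields that span
`equivalenceSpan`. -/
def equivalenceField (c : Fin 7 → ℝ) (z : ExtSpace) : ExtSpace :=
  ![(2 * c 5 + c 6) * z 0 + c 0, c 5 * z 1 + c 4 * z 0 + c 1, c 3 * z 2 + c 2, -c 6 * z 3,
    -(c 5 + c 6) * z 4 - c 4]

theorem mem_equivalenceSpan_iff {W : ExtSpace → ExtSpace} :
    W ∈ equivalenceSpan ↔ ∃ c, W = equivalenceField c := by
  let generator : Fin 7 → ExtSpace → ExtSpace :=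
    ![fun _ => ![1, 0, 0, 0, 0], fun _ => ![0, 1, 0, 0, 0], fun _ => ![0, 0, 1, 0, 0],
      fun z => ![0, 0, z 2, 0, 0], fun z => ![0, z 0, 0, 0, -1],
      fun z => ![2 * z 0, z 1, 0, 0, -z 4], fun z => ![z 0, 0, 0, -z 3, -z 4]]
  have hspan : equivalenceSpan = Submodule.span ℝ (range generator) := by
    simp only [equivalenceSpan, generator, Matrix.range_cons, Matrix.range_empty, union_empty,
      singleton_union]
  have hsum (c : Fin 7 → ℝ) : ∑ i, c i • generator i = equivalenceField c := by
    ext z i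
    rw [Fin.sum_univ_seven]
    fin_cases i <;> simp [generator, equivalenceField] <;> ring
  simp only [hspan, Submodule.mem_span_range_iff_exists_fun, hsum, eq_comm]

theorem contDiff_equivalenceField (c : Fin 7 → ℝ) {n : ℕ∞ω} :
    ContDiff ℝ n (equivalenceField c) := by
  refine contDiff_pi.2 fun i => ?_
  fin_cases i <;> simp only [equivalenceField, Fin.reduceFinMk, Matrix.cons_val] <;> fun_prop

/-- The group parameters of the identity. -/
def identityParameters : Fin 7 → ℝ := ![0, 0, 0, 1, 1, 1, 0]

theorem equivalenceMap_identityParameters (z : ExtSpace) :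
    equivalenceMap identityParameters z = z := by
  ext i
  fin_cases i <;> simp [equivalenceMap, identityParameters]

/-- The vector field on the space of group parameters whose integral curves are the one-parameter
families of transformations generated by `equivalenceField c`. -/
def parameterField (c ε : Fin 7 → ℝ) : Fin 7 → ℝ :=
  ![(2 * c 5 + c 6) * ε 0 + c 0, c 5 * ε 1 + c 4 * ε 0 + c 1, c 3 * ε 2 + c 2, c 5 * ε 3,
    c 6 * ε 4, c 3 * ε 5, c 5 * ε 6 + c 4 * (ε 3 ^ 2 * ε 4)]

theorem hasDerivAt_equivalenceMap {c : Fin 7 → ℝ} {ε : ℝ → Fin 7 → ℝ} {s : ℝ} (h₃ : ε s 3 ≠ 0)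
    (h₄ : ε s 4 ≠ 0) (hε : HasDerivAt ε (parameterField c (ε s)) s) (z : ExtSpace) :
    HasDerivAt (fun r => equivalenceMap (ε r) z) (equivalenceField c (equivalenceMap (ε s) z))
      s := by
  have hε (i : Fin 7) : HasDerivAt (fun r => ε r i) (parameterField c (ε s) i) s :=
    hasDerivAt_pi.1 hε i
  have hinv₃ := (hε 3).fun_inv h₃
  have hinv₄ := (hε 4).fun_inv h₄
  have hinvsq := ((hε 3).fun_pow 2).fun_inv (pow_ne_zero 2 h₃)
  refine hasDerivAt_pi.2 fun i => ?_
  fin_cases i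
  · refine (((((hε 3).fun_pow 2).const_mul (z 0)).fun_mul (hε 4)).fun_add (hε 0)).congr_deriv ?_
    simp only [equivalenceField, equivalenceMap, parameterField, Fin.reduceFinMk, Matrix.cons_val]
    ring
  · refine ((((hε 3).const_mul (z 1)).fun_add ((hε 6).mul_const (z 0))).fun_add
      (hε 1)).congr_deriv ?_
    simp only [equivalenceField, equivalenceMap, parameterField, Fin.reduceFinMk, Matrix.cons_val]
    ring
  · refine (((hε 5).const_mul (z 2)).fun_add (hε 2)).congr_deriv ?_
    simp only [equivalenceField, equivalenceMap, parameterField, Fin.reduceFinMk, Matrix.cons_val]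
    ring
  · refine (hinv₄.const_mul (z 3)).congr_deriv ?_
    simp only [equivalenceField, equivalenceMap, parameterField, Fin.reduceFinMk, Matrix.cons_val]
    field_simp
  · refine (((hinv₃.const_mul (z 4)).fun_mul hinv₄).fun_sub
      (((hε 6).fun_mul hinvsq).fun_mul hinv₄)).congr_deriv ?_
    simp only [equivalenceField, equivalenceMap, parameterField, Fin.reduceFinMk, Matrix.cons_val]
    field_simp
    ring

section Generator

/-- The group parameters of a map `f` of the form `equivalenceMap ε`, read off from the values of
`f` at `z` and at the shifts of `z` by `h` along the `t`-, `x`- and `u`-axes. -/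
noncomputable def parametersOf (f : ExtSpace → ExtSpace) (z : ExtSpace) (h : ℝ) : Fin 7 → ℝ :=
  let slope (i j : Fin 5) : ℝ := (f (z + Pi.single j h) i - f z i) / h
  let scale : ℝ := (f z 3 / z 3)⁻¹
  ![f z 0 - z 0 * slope 1 1 ^ 2 * scale, f z 1 - z 1 * slope 1 1 - slope 1 0 * z 0,
    f z 2 - z 2 * slope 2 2, slope 1 1, scale, slope 2 2, slope 1 0]

theorem parametersOf_eq {f : ExtSpace → ExtSpace} {ε : Fin 7 → ℝ} {S : Set ExtSpace}
    {z : ExtSpace} {h : ℝ} (hf : EqOn f (equivalenceMap ε) S) (hz : z ∈ S) (hz₃ : z 3 ≠ 0)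
    (hh : h ≠ 0) (hS : ∀ j, z + Pi.single j h ∈ S) : parametersOf f z h = ε := by
  have hfz := hf hz
  have hslope (i j : Fin 5) := congrFun (hf (hS j)) i
  ext i
  fin_cases i <;> simp [parametersOf, hfz, hslope, equivalenceMap, hz₃] <;> field_simp <;> ring

theorem differentiableAt_parametersOf {F : ℝ → ExtSpace → ExtSpace} {S : Set ExtSpace}
    {z : ExtSpace} {h s : ℝ} (hF : ∀ y ∈ S, DifferentiableAt ℝ (fun r => F r y) s) (hz : z ∈ S)
    (hne : F s z 3 / z 3 ≠ 0) (hS : ∀ j, z + Pi.single j h ∈ S) :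
    DifferentiableAt ℝ (fun r => parametersOf (F r) z h) s := by
  have hFz := differentiableAt_pi.1 (hF z hz)
  have hslope (j : Fin 5) := differentiableAt_pi.1 (hF _ (hS j))
  have : DifferentiableAt ℝ (fun r => (F r z 3 / z 3)⁻¹) s :=
    ((hFz 3).div_const _).fun_inv hne
  refine differentiableAt_pi.2 fun i => ?_
  fin_cases i <;> simp only [parametersOf, Fin.reduceFinMk, Matrix.cons_val] <;> fun_prop

theorem exists_forall_add_single_mem {ι : Type*} [Finite ι] [DecidableEq ι] {N : Set (ι → ℝ)}
    {z : ι → ℝ} (hN : N ∈ 𝓝 z) : ∃ h : ℝ, h ≠ 0 ∧ ∀ j, z + Pi.single j h ∈ N := by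
  have hnear (j : ι) : ∀ᶠ h in 𝓝[≠] (0 : ℝ), z + Pi.single j h ∈ N := by
    have hcont : Continuous fun h : ℝ => z + Pi.single j h :=
      continuous_const.add (continuous_single (A := fun _ : ι => ℝ) j)
    exact (hcont.continuousAt.eventually_mem (by simpa using hN)).filter_mono nhdsWithin_le_nhds
  exact (eventually_mem_nhdsWithin.and (eventually_all.2 hnear)).exists

theorem exists_equivalenceField_of_family {F : ℝ → ExtSpace → ExtSpace}
    {V : ExtSpace → ExtSpace} {N : Set ExtSpace} {z₀ : ExtSpace} (hN : N ∈ 𝓝 z₀) (hz₀ : z₀ 3 ≠ 0)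
    (hF₀ : ∀ z ∈ N, F 0 z = z) (hF : ∀ z ∈ N, HasDerivAt (fun s => F s z) (V z) 0)
    (hfamily : ∀ᶠ s in 𝓝 (0 : ℝ), ∃ ε, EqOn (F s) (equivalenceMap ε) N) :
    ∃ c, EqOn V (equivalenceField c) N := by
  have hz₀N : z₀ ∈ N := mem_of_mem_nhds hN
  obtain ⟨h, hh, hshift⟩ := exists_forall_add_single_mem hN
  let ε (s : ℝ) : Fin 7 → ℝ := parametersOf (F s) z₀ h
  have hε : ∀ᶠ s in 𝓝 (0 : ℝ), EqOn (F s) (equivalenceMap (ε s)) N := by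
    filter_upwards [hfamily] with s ⟨ε', hε'⟩
    rwa [show ε s = ε' from parametersOf_eq hε' hz₀N hz₀ hh hshift]
  have hε₀ : ε 0 = identityParameters :=
    parametersOf_eq (fun z hz => (hF₀ z hz).trans (equivalenceMap_identityParameters z).symm)
      hz₀N hz₀ hh hshift
  have hdiff : DifferentiableAt ℝ ε 0 :=
    differentiableAt_parametersOf (fun z hz => (hF z hz).differentiableAt) hz₀N
      (by rw [hF₀ z₀ hz₀N, div_self hz₀]; exact one_ne_zero) hshift
  let v := deriv ε 0
  let c : Fin 7 → ℝ := ![v 0, v 1, v 2, v 5, v 6, v 3, v 4]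
  have hv : HasDerivAt ε (parameterField c (ε 0)) 0 := by
    refine hdiff.hasDerivAt.congr_deriv ?_
    rw [hε₀]
    ext i
    fin_cases i <;> simp [parameterField, identityParameters, c, v]
  refine ⟨c, fun z hz => (hF z hz).unique ?_⟩
  have hmap := hasDerivAt_equivalenceMap (by simp [hε₀, identityParameters])
    (by simp [hε₀, identityParameters]) hv z
  rw [hε₀, equivalenceMap_identityParameters] at hmap
  exact hmap.congr_of_eventuallyEq (hε.mono fun s hs => hs hz)

end Generator

theorem IsEquivalenceOperatorOn.eventuallyEq_equivalenceField {Ω : Set ExtSpace}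
    {V : ExtSpace → ExtSpace} (h : IsEquivalenceOperatorOn Ω V) (hsub : Ω ⊆ diffusiveRegion)
    {z₀ : ExtSpace} (hz₀ : z₀ ∈ Ω) : ∃ c, V =ᶠ[𝓝 z₀] equivalenceField c := by
  obtain ⟨δ, hδ, N, hN, hz₀N, F, hF₀, hF, hΦ⟩ := h.flow z₀ hz₀
  obtain ⟨ρ, hρ, hball⟩ := Metric.isOpen_iff.1 hN z₀ hz₀N
  have hzero : (0 : ℝ) ∈ Ioo (-δ) δ := ⟨neg_neg_of_pos hδ, hδ⟩
  obtain ⟨c, hc⟩ := exists_equivalenceField_of_family (Metric.ball_mem_nhds z₀ hρ) (hsub hz₀)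
    (fun z hz => hF₀ z (hball hz))
    (fun z hz => by simpa only [hF₀ z (hball hz)] using (hF 0 hzero z (hball hz)).2)
    (eventually_of_mem (isOpen_Ioo.mem_nhds hzero) fun s hs => by
      obtain ⟨Φ, hΦ, hsource, hΦF⟩ := hΦ s hs
      obtain ⟨ε, -, hε⟩ := hΦ.exists_eqOn_equivalenceMap Metric.isOpen_ball
        (convex_ball z₀ ρ).isPreconnected (hball.trans_eq hsource.symm)
      exact ⟨ε, (hΦF.mono hball).symm.trans hε⟩)
  exact ⟨c, eventually_of_mem (Metric.ball_mem_nhds z₀ hρ) hc⟩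

theorem IsEquivalenceOperatorOn.exists_eqOn {Ω : Set ExtSpace} {V : ExtSpace → ExtSpace}
    (h : IsEquivalenceOperatorOn Ω V) (hΩ : IsPreconnected Ω) (hsub : Ω ⊆ diffusiveRegion) :
    ∃ c, EqOn V (equivalenceField c) Ω := by
  rcases Ω.eq_empty_or_nonempty with rfl | ⟨z, hz⟩
  · exact ⟨0, eqOn_empty _ _⟩
  have hfield (c : Fin 7 → ℝ) : AnalyticOnNhd ℝ (equivalenceField c) univ :=
    contDiff_omega_iff_analyticOnNhd.1 (contDiff_equivalenceField c)
  have hV : AnalyticOnNhd ℝ V Ω := fun y hy => by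
    obtain ⟨c, hc⟩ := h.eventuallyEq_equivalenceField hsub hy
    exact (hfield c y (mem_univ y)).congr hc.symm
  obtain ⟨c, hc⟩ := h.eventuallyEq_equivalenceField hsub hz
  exact ⟨c, hV.eqOn_of_preconnected_of_eventuallyEq ((hfield c).mono (subset_univ Ω)) hΩ hz hc⟩

section Flow

theorem hasDerivAt_exp_const_mul (m s : ℝ) :
    HasDerivAt (fun r => Real.exp (m * r)) (m * Real.exp (m * s)) s := by
  simpa [mul_comm] using ((hasDerivAt_id s).const_mul m).exp

theorem exists_hasDerivAt_linear (m : ℝ) {g : ℝ → ℝ} (hg : Continuous g) :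
    ∃ y : ℝ → ℝ, y 0 = 0 ∧ ∀ s, HasDerivAt y (m * y s + g s) s := by
  let P (s : ℝ) : ℝ := ∫ r in (0 : ℝ)..s, Real.exp (-m * r) * g r
  have hP (s : ℝ) : HasDerivAt P (Real.exp (-m * s) * g s) s :=
    ((by fun_prop : Continuous fun r => Real.exp (-m * r) * g r).integral_hasStrictDerivAt 0
      s).hasDerivAt
  refine ⟨fun s => Real.exp (m * s) * P s, by simp [P], fun s => ?_⟩
  refine ((hasDerivAt_exp_const_mul m s).mul (hP s)).congr_deriv ?_
  have hexp : Real.exp (m * s) * Real.exp (-m * s) = 1 := by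
    rw [← Real.exp_add, neg_mul, add_neg_cancel, Real.exp_zero]
  linear_combination g s * hexp

theorem exists_integralCurve_parameterField (c : Fin 7 → ℝ) :
    ∃ ε : ℝ → Fin 7 → ℝ, ε 0 = identityParameters ∧
      (∀ s, HasDerivAt ε (parameterField c (ε s)) s) ∧
      ∀ s, ε s 3 ≠ 0 ∧ ε s 4 ≠ 0 ∧ ε s 5 ≠ 0 := by
  obtain ⟨e₀, he₀, he₀'⟩ := exists_hasDerivAt_linear (2 * c 5 + c 6) (continuous_const (y := c 0))
  have hcont : Continuous e₀ := continuous_iff_continuousAt.2 fun s => (he₀' s).continuousAt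
  obtain ⟨e₁, he₁, he₁'⟩ := exists_hasDerivAt_linear (c 5)
    (by fun_prop : Continuous fun s => c 4 * e₀ s + c 1)
  obtain ⟨e₂, he₂, he₂'⟩ := exists_hasDerivAt_linear (c 3) (continuous_const (y := c 2))
  obtain ⟨e₆, he₆, he₆'⟩ := exists_hasDerivAt_linear (c 5)
    (by fun_prop : Continuous fun s => c 4 * (Real.exp (c 5 * s) ^ 2 * Real.exp (c 6 * s)))
  refine ⟨fun s => ![e₀ s, e₁ s, e₂ s, Real.exp (c 5 * s), Real.exp (c 6 * s), Real.exp (c 3 * s),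
    e₆ s], ?_, fun s => hasDerivAt_pi.2 fun i => ?_, fun s => by simp⟩
  · simp [identityParameters, he₀, he₁, he₂, he₆]
  · fin_cases i
    · exact he₀' s
    · exact (he₁' s).congr_deriv (add_assoc _ _ _).symm
    · exact he₂' s
    · exact hasDerivAt_exp_const_mul (c 5) s
    · exact hasDerivAt_exp_const_mul (c 6) s
    · exact hasDerivAt_exp_const_mul (c 3) s
    · exact he₆' s

theorem continuous_uncurry_equivalenceMap {ε : ℝ → Fin 7 → ℝ} (hε : Continuous ε)
    (h₃ : ∀ s, ε s 3 ≠ 0) (h₄ : ∀ s, ε s 4 ≠ 0) :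
    Continuous fun p : ℝ × ExtSpace => equivalenceMap (ε p.1) p.2 := by
  have hε' (i : Fin 7) : Continuous fun p : ℝ × ExtSpace => ε p.1 i := by fun_prop
  have hinv₃ : Continuous fun p : ℝ × ExtSpace => (ε p.1 3)⁻¹ := (hε' 3).inv₀ fun p => h₃ p.1
  have hinv₄ : Continuous fun p : ℝ × ExtSpace => (ε p.1 4)⁻¹ := (hε' 4).inv₀ fun p => h₄ p.1
  have hinvsq : Continuous fun p : ℝ × ExtSpace => (ε p.1 3 ^ 2)⁻¹ :=
    ((hε' 3).pow 2).inv₀ fun p => pow_ne_zero 2 (h₃ p.1)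
  refine continuous_pi fun i => ?_
  fin_cases i <;> simp only [equivalenceMap, Fin.reduceFinMk, Matrix.cons_val] <;> fun_prop

theorem exists_isEquivalenceTransformation_eqOn {ε : Fin 7 → ℝ} (h₃ : ε 3 ≠ 0) (h₄ : ε 4 ≠ 0)
    (h₅ : ε 5 ≠ 0) {N : Set ExtSpace} (hN : IsOpen N) (hsub : N ⊆ diffusiveRegion) :
    ∃ Φ : OpenPartialHomeomorph ExtSpace ExtSpace,
      IsEquivalenceTransformation Φ ∧ Φ.source = N ∧ EqOn Φ (equivalenceMap ε) N := by
  let Φ := (equivalenceHomeomorph ε h₃ h₄ h₅).toOpenPartialHomeomorph.restrOpen N hN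
  have hsource : Φ.source = N := by simp [Φ]
  exact ⟨Φ, isEquivalenceTransformation_of_eqOn (hsource.trans_subset hsub)
    (mul_ne_zero (mul_ne_zero h₃ h₄) h₅) fun _ _ => rfl, hsource, fun _ _ => rfl⟩

theorem isEquivalenceOperatorOn_of_eqOn {Ω : Set ExtSpace} (hΩ : IsOpen Ω)
    (hsub : Ω ⊆ diffusiveRegion) {V : ExtSpace → ExtSpace} {c : Fin 7 → ℝ}
    (hV : EqOn V (equivalenceField c) Ω) : IsEquivalenceOperatorOn Ω V := by
  refine ⟨(contDiff_equivalenceField c).contDiffOn.congr hV, fun z₀ hz₀ => ?_⟩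
  obtain ⟨ε, hε₀, hε, hne⟩ := exists_integralCurve_parameterField c
  have hid (z : ExtSpace) : equivalenceMap (ε 0) z = z := by
    rw [hε₀, equivalenceMap_identityParameters]
  have hcont := continuous_uncurry_equivalenceMap
    (continuous_iff_continuousAt.2 fun s => (hε s).continuousAt) (fun s => (hne s).1)
    fun s => (hne s).2.1
  obtain ⟨δ, hδ, hball⟩ := Metric.eventually_nhds_iff_ball.1 <|
    hcont.continuousAt.eventually_mem (x := (0, z₀)) (hΩ.mem_nhds ((hid z₀).symm ▸ hz₀))
  have hmem {s : ℝ} {z : ExtSpace} (hs : s ∈ Ioo (-δ) δ) (hz : z ∈ Metric.ball z₀ δ) :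
      equivalenceMap (ε s) z ∈ Ω := by
    refine hball (s, z) ?_
    rw [← ball_prod_same, Real.ball_eq_Ioo, zero_sub, zero_add]
    exact ⟨hs, hz⟩
  have hN : Metric.ball z₀ δ ⊆ diffusiveRegion := fun z hz =>
    hsub (hid z ▸ hmem ⟨neg_neg_of_pos hδ, hδ⟩ hz)
  refine ⟨δ, hδ, Metric.ball z₀ δ, Metric.isOpen_ball, Metric.mem_ball_self hδ,
    fun s => equivalenceMap (ε s), fun z _ => hid z, fun s hs z hz => ⟨hmem hs hz, ?_⟩,
    fun s _ => exists_isEquivalenceTransformation_eqOn (hne s).1 (hne s).2.1 (hne s).2.2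
      Metric.isOpen_ball hN⟩
  rw [hV (hmem hs hz)]
  exact hasDerivAt_equivalenceMap (hne s).1 (hne s).2.1 (hε s) z

end Flow

end EquivalenceField

theorem theorem6 :
    (∀ Ω : Set ExtSpace, IsOpen Ω → IsPreconnected Ω → Ω ⊆ diffusiveRegion →
      ∀ V : ExtSpace → ExtSpace,
        IsEquivalenceOperatorOn Ω V ↔ ∃ W ∈ equivalenceSpan, EqOn V W Ω) ∧
    (∀ Φ : OpenPartialHomeomorph ExtSpace ExtSpace,
      IsPreconnected Φ.source → Φ.source ⊆ diffusiveRegion →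
        (IsEquivalenceTransformation Φ ↔
          ∃ ε₁ ε₂ ε₃ ε₄ ε₅ ε₆ ε₇ : ℝ, ε₄ * ε₅ * ε₆ ≠ 0 ∧
            ∀ z ∈ Φ.source, Φ z =
              ![z 0 * ε₄ ^ 2 * ε₅ + ε₁,
                z 1 * ε₄ + ε₇ * z 0 + ε₂,
                z 2 * ε₆ + ε₃,
                z 3 * ε₅⁻¹,
                z 4 * ε₄⁻¹ * ε₅⁻¹ - ε₇ * (ε₄ ^ 2)⁻¹ * ε₅⁻¹])) := by
  refine ⟨fun Ω hΩ hΩ' hsub V => ⟨fun h => ?_, ?_⟩, fun Φ hpre hsub => ⟨fun h => ?_, ?_⟩⟩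
  · obtain ⟨c, hc⟩ := h.exists_eqOn hΩ' hsub
    exact ⟨equivalenceField c, mem_equivalenceSpan_iff.2 ⟨c, rfl⟩, hc⟩
  · rintro ⟨W, hW, hVW⟩
    obtain ⟨c, rfl⟩ := mem_equivalenceSpan_iff.1 hW
    exact isEquivalenceOperatorOn_of_eqOn hΩ hsub hVW
  · obtain ⟨ε, hε, hΦ⟩ := h.exists_eqOn_equivalenceMap Φ.open_source hpre subset_rfl
    exact ⟨ε 0, ε 1, ε 2, ε 3, ε 4, ε 5, ε 6, hε, hΦ⟩
  · rintro ⟨ε₁, ε₂, ε₃, ε₄, ε₅, ε₆, ε₇, hε, hΦ⟩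
    exact isEquivalenceTransformation_of_eqOn hsub (ε := ![ε₁, ε₂, ε₃, ε₄, ε₅, ε₆, ε₇]) hε hΦ
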